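/- Graphs are finite and nonempty and may have loops and multiple edges; $d_G(v)$ denotes the degree of $v$ in $G$, each loop counting twice. A graph is $k$-edge-connected if it remains connected whenever fewer than $k$ edges are deleted, and $m$-tree-connected if it contains $m$ pairwise edge-disjoint spanning trees. A factor of $G$ is a spanning subgraph $H$ of $G$; its complement is $G\setminus E(H)$. For $f:V(G)\to \mathbb{Z}_2$, an $f$-factor is a factor $H$ such that $d_H(v)\equiv f(v) \pmod 2$ for each vertex $v$. Theorem. Let $G$ be a graph, let $m,m_0\ge 0$ be integers, and let $f:V(G)\to \mathbb{Z}_2$ be a mapping with $\sum_{v\in V(G)}f(v)\equiv 0 \pmod 2$. If $G$ is $(2m+2m_0+2)$-edge-connected, then $G$ has an $m$-tree-connected $f$-factor $H$ such that its complement is $m_0$-tree-connected and for each vertex $v$, $$\Big\lfloor \frac{d_G(v)}{2}\Big\rfloor-1-m_0\le d_H(v)\le \Big\lceil \frac{d_G(v)}{2}\Big\rceil+1+m .$$ Furthermore, for an arbitrary given vertex $z$ and an arbitrary integer $t$ with $\lfloor d_G(z)/2\rfloor-1-m_0\le t\le \lceil d_G(z)/2\rceil+1+m$, $0\le t\le d_G(z)$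 and $t\equiv f(z)\pmod 2$, such a factor $H$ can be chosen with $d_H(z)=t$. (The condition $0\le t\le d_G(z)$ is automatic when $G$ has at least two vertices.) -/

import Mathlib

open scoped Graph

namespace Graph

variable {α β : Type*}

/-- The degree of `v` in the multigraph `G`; each loop at `v` counts twice. -/
noncomputable def degree (G : Graph α β) (v : α) : ℕ :=
  {e | G.IsNonloopAt e v}.ncard + 2 * {e | G.IsLoopAt e v}.ncard

/-- `G` is connected: it has a vertex, and any two vertices are joined by a walk. -/
def Connected (G : Graph α β) : Prop :=
  V(G).Nonempty ∧ ∀ x ∈ V(G), ∀ y ∈ V(G), Relation.ReflTransGen G.Adj x y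

/-- `G` has no cycle. A cycle of length `n + 1` consists of distinct vertices `v 0, …, v n` and
distinct edges `e 0, …, e n`, where `e i` joins `v i` to `v (i + 1)` with indices modulo `n + 1`
(addition in `Fin (n + 1)` is cyclic). A loop is a cycle of length `1`, and two parallel edges
form a cycle of length `2`. -/
def Acyclic (G : Graph α β) : Prop :=
  ¬ ∃ (n : ℕ) (v : Fin (n + 1) → α) (e : Fin (n + 1) → β),
    Function.Injective v ∧ Function.Injective e ∧ ∀ i, G.IsLink (e i) (v i) (v (i + 1))

/-- A tree is a connected graph without cycles. -/
def IsTree (G : Graph α β) : Prop :=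
  G.Connected ∧ G.Acyclic

/-- `G` is `k`-edge-connected: it stays connected when fewer than `k` edges are deleted. -/
def EdgeConnected (G : Graph α β) (k : ℕ) : Prop :=
  ∀ S ⊆ E(G), S.encard < k → (G.deleteEdges S).Connected

/-- `G` is `m`-tree-connected: it contains `m` pairwise edge-disjoint spanning trees. -/
def TreeConnected (G : Graph α β) (m : ℕ) : Prop :=
  ∃ T : Fin m → Graph α β, (∀ i, T i ≤s G ∧ (T i).IsTree) ∧
    ∀ i j, i ≠ j → Disjoint E(T i) E(T j)

/-- `H` is an `f`-factor of `G` (modulo `2`): a spanning subgraph with `d_H(v) ≡ f(v) (mod 2)` for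
each vertex `v`. -/
def IsModTwoFactor (G H : Graph α β) (f : α → ZMod 2) : Prop :=
  H ≤s G ∧ ∀ v ∈ V(G), (H.degree v : ZMod 2) = f v

/-- `H` is an `m`-tree-connected `f`-factor of `G` (modulo `2`) whose complement `G \ E(H)` is
`m₀`-tree-connected, and `⌊d_G(v)/2⌋ - 1 - m₀ ≤ d_H(v) ≤ ⌈d_G(v)/2⌉ + 1 + m` for each vertex
`v`. -/
def IsBoundedTreeFactor (G H : Graph α β) (f : α → ZMod 2) (m m₀ : ℕ) : Prop :=
  IsModTwoFactor G H f ∧ H.TreeConnected m ∧ (G.deleteEdges E(H)).TreeConnected m₀ ∧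
    ∀ v ∈ V(G), ⌊(G.degree v : ℚ) / 2⌋ - 1 - (m₀ : ℤ) ≤ (H.degree v : ℤ) ∧
      (H.degree v : ℤ) ≤ ⌈(G.degree v : ℚ) / 2⌉ + 1 + (m : ℤ)

end Graph

/-! Put k = m + m₀ + 1 and fix a root z. Since G is 2k-edge-connected, it has an orientation in
which every nonempty vertex set avoiding z is entered by at least k arcs and every in-degree is half
the degree up to rounding (`exists_balanced_orientation`). By Edmonds' theorem
(`exists_disjoint_arborescences`) it contains k disjoint spanning arborescences rooted at z. Of
these, m go into H and m₀ into its complement; the last one only guarantees that z still reaches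
every vertex in the digraph R of undecided arcs.

The arcs of R are decided by `ParityBounds.solvable`: when z reaches everything, a subset can be
chosen with degrees of prescribed parity (of even total) in intervals [lb v, ub v] with lb v ≤
in-degree and out-degree ≤ ub v, each relaxed by 1 at z. The proof is an induction on vertices and
arcs. An arc not needed for reachability is deleted if its head has slack, and otherwise merged with
an arc leaving its head; if the last vertex reached has just one arc, that vertex is pruned. Merging
forces the general form in which the two ends of an arc carry separate values in {0, 1} whose sum
has a prescribed parity.

At v ≠ z the reserved arborescences have in-degrees m and m₀, which yields the thresholds ⌊d/2⌋ - m₀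
and ⌈d/2⌉ + m; one further unit on each side adjusts the parity. At z each reserved arborescence has
an outgoing arc and no incoming one. With the in-degree of z rounded up and the slack 1 at the root,
this leaves room for every admissible t, taken as both lower and upper bound. -/

namespace Arcs

open Relation

variable {α β : Type*}

/-! ### Parity-constrained choices of arcs in a rooted digraph -/

open Classical in
/-- The sum of `x e` over all arcs `e ∈ E` whose end `p e` is `v`. -/
noncomputable def endSum (E : Finset β) (p : β → α) (x : β → ℤ) (v : α) : ℤ :=
  ∑ e ∈ E, if p e = v then x e else 0

/-- `b` is the head of an arc of `E` with tail `a`. -/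
def Step (E : Finset β) (t h : β → α) (a b : α) : Prop := ∃ e ∈ E, t e = a ∧ h e = b

/-- Every vertex of `V` can be reached from `z` along arcs of `E`. -/
def Spans (V : Finset α) (E : Finset β) (t h : β → α) (z : α) : Prop :=
  ∀ v ∈ V, ReflTransGen (Step E t h) z v

open Classical in
lemma endSum_erase {E : Finset β} {e : β} (he : e ∈ E) (p : β → α) (x : β → ℤ) (v : α) :
    endSum E p x v = endSum (E.erase e) p x v + if p e = v then x e else 0 := by
  unfold endSum
  rw [Finset.sum_erase_add _ _ he]

lemma endSum_congr {E : Finset β} {p q : β → α} {x y : β → ℤ} (hp : ∀ e ∈ E, p e = q e)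
    (hx : ∀ e ∈ E, x e = y e) (v : α) : endSum E p x v = endSum E q y v := by
  refine Finset.sum_congr rfl fun e he => ?_
  rw [hp e he, hx e he]

lemma endSum_nonneg {E : Finset β} {p : β → α} {x : β → ℤ} (hx : ∀ e ∈ E, 0 ≤ x e) (v : α) :
    0 ≤ endSum E p x v := by
  refine Finset.sum_nonneg fun e he => ?_
  split_ifs
  · exact hx e he
  · exact le_rfl

lemma Step.mono {E E' : Finset β} (hE : E ⊆ E') {t h : β → α} {a b : α} (H : Step E t h a b) :
    Step E' t h a b := by
  obtain ⟨e, he, h1⟩ := H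
  exact ⟨e, hE he, h1⟩

open Classical in
/-- Bounds `lb` and `ub` on the signed degrees of arcs, such that every vertex can be adjusted
through its incoming arcs; the root `z` has slack `1`. -/
structure ParityBounds (V : Finset α) (E : Finset β) (t h : β → α) (z : α) (s : β → ℤ)
    (lb ub : α → ℤ) : Prop where
  root_mem : z ∈ V
  tail_mem : ∀ e ∈ E, t e ∈ V
  head_mem : ∀ e ∈ E, h e ∈ V
  spans : Spans V E t h z
  le : ∀ v ∈ V, lb v ≤ ub v
  even_sub : ∀ v ∈ V, Even (ub v - lb v)
  lb_le : ∀ v ∈ V, lb v ≤ endSum E h 1 v + if v = z then 1 else 0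
  le_ub : ∀ v ∈ V, endSum E t 1 v - (if v = z then 1 else 0) ≤ ub v
  even_sum : Even (∑ v ∈ V, lb v - ∑ e ∈ E, s e)

/-- A choice of `x e, y e ∈ {0, 1}` at the tail and the head of each arc `e`, with
`x e + y e ≡ s e (mod 2)`, whose sums at the vertices lie between `lb` and `ub` and have the parity
of `lb`. -/
def ParitySolvable (V : Finset α) (E : Finset β) (t h : β → α) (s : β → ℤ) (lb ub : α → ℤ) :
    Prop :=
  ∃ x y : β → ℤ, (∀ e ∈ E, (x e = 0 ∨ x e = 1) ∧ (y e = 0 ∨ y e = 1) ∧ Even (x e + y e - s e)) ∧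
    ∀ v ∈ V, lb v ≤ endSum E t x v + endSum E h y v ∧ endSum E t x v + endSum E h y v ≤ ub v ∧
      Even (endSum E t x v + endSum E h y v - lb v)

lemma exists_parity (a : ℤ) : ∃ x : ℤ, (x = 0 ∨ x = 1) ∧ Even (x - a) := by
  rcases Int.even_or_odd a with h | h
  · exact ⟨0, .inl rfl, by simpa using h⟩
  · exact ⟨1, .inr rfl, by rw [Int.even_sub']; simp [h]⟩

open Classical in
/-- Fixing the values of an arc `e` at its two ends. -/
lemma ParitySolvable.of_erase {V : Finset α} {E : Finset β} {t h : β → α} {s : β → ℤ}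
    {lb ub : α → ℤ} {e : β} (he : e ∈ E) {a b : ℤ} (ha : a = 0 ∨ a = 1) (hb : b = 0 ∨ b = 1)
    (hab : Even (a + b - s e))
    (H : ParitySolvable V (E.erase e) t h s
      (fun v => lb v - (if t e = v then a else 0) - (if h e = v then b else 0))
      (fun v => ub v - (if t e = v then a else 0) - (if h e = v then b else 0))) :
    ParitySolvable V E t h s lb ub := by
  obtain ⟨x, y, hxy, hv⟩ := H
  refine ⟨Function.update x e a, Function.update y e b, ?_, ?_⟩
  · intro f hf
    by_cases hfe : f = e
    · subst hfe
      simpa using ⟨ha, hb, hab⟩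
    · simpa [hfe] using hxy f (Finset.mem_erase.2 ⟨hfe, hf⟩)
  · intro v hvV
    have h1 : endSum E t (Function.update x e a) v =
        endSum (E.erase e) t x v + if t e = v then a else 0 := by
      rw [endSum_erase he]
      congr 1
      · exact endSum_congr (fun _ _ => rfl)
          (fun f hf => by simp [Finset.ne_of_mem_erase hf]) v
      · simp
    have h2 : endSum E h (Function.update y e b) v =
        endSum (E.erase e) h y v + if h e = v then b else 0 := by
      rw [endSum_erase he]
      congr 1
      · exact endSum_congr (fun _ _ => rfl)
          (fun f hf => by simp [Finset.ne_of_mem_erase hf]) v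
      · simp
    obtain ⟨h3, h4, h5⟩ := hv v hvV
    rw [h1, h2]
    refine ⟨by linarith, by linarith, ?_⟩
    convert h5 using 1
    ring

open Classical in
/-- Deleting a removable arc from the data, with value `b` at its head. -/
lemma ParityBounds.erase {V : Finset α} {E : Finset β} {t h : β → α} {z : α} {s : β → ℤ}
    {lb ub : α → ℤ} (H : ParityBounds V E t h z s lb ub) {e : β} (he : e ∈ E)
    (hsp : Spans V (E.erase e) t h z) {a b : ℤ} (ha : a = 0 ∨ a = 1)
    (hab : Even (a + b - s e))
    (hb : (b = 0 ∧ lb (h e) < endSum E h 1 (h e) + if h e = z then 1 else 0) ∨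
      (b = 1 ∧ endSum E t 1 (h e) - (if h e = z then 1 else 0) < ub (h e))) :
    ParityBounds V (E.erase e) t h z s
      (fun v => lb v - (if t e = v then a else 0) - (if h e = v then b else 0))
      (fun v => ub v - (if t e = v then a else 0) - (if h e = v then b else 0)) where
  root_mem := H.root_mem
  tail_mem f hf := H.tail_mem f (Finset.mem_of_mem_erase hf)
  head_mem f hf := H.head_mem f (Finset.mem_of_mem_erase hf)
  spans := hsp
  le v hv := by have := H.le v hv; linarith
  even_sub v hv := by
    have := H.even_sub v hv
    convert this using 1
    ring
  -- The value `a` at the tail costs nothing: `ub` drops by at most 1 there, as does the out-degree.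
  -- At the head, `b = 0` leaves `lb` in place while the in-degree drops, and `b = 1` lowers `ub`
  -- without an outgoing arc to match; the strict inequality in `hb` pays for this.
  lb_le v hv := by
    have h1 := H.lb_le v hv
    rw [endSum_erase he] at h1
    by_cases hev : h e = v
    · subst hev
      rw [endSum_erase he] at hb
      simp only [if_true, Pi.one_apply] at h1 hb ⊢
      split_ifs at h1 hb ⊢ <;> omega
    · simp only [if_neg hev] at h1 ⊢
      split_ifs at h1 ⊢ <;> omega
  le_ub v hv := by
    have h1 := H.le_ub v hv
    rw [endSum_erase he] at h1
    by_cases hev : h e = v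
    · subst hev
      rw [endSum_erase he t] at hb
      simp only [if_true, Pi.one_apply] at h1 hb ⊢
      split_ifs at h1 hb ⊢ <;> omega
    · simp only [if_neg hev] at h1 ⊢
      simp only [Pi.one_apply] at h1
      split_ifs at h1 ⊢ <;> omega
  even_sum := by
    have h1 := H.even_sum
    rw [← Finset.sum_erase_add _ _ he] at h1
    have h2 : ∑ v ∈ V, (lb v - (if t e = v then a else 0) - (if h e = v then b else 0)) =
        ∑ v ∈ V, lb v - a - b := by
      rw [Finset.sum_sub_distrib, Finset.sum_sub_distrib, Finset.sum_ite_eq, Finset.sum_ite_eq,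
        if_pos (H.tail_mem e he), if_pos (H.head_mem e he)]
    rw [h2]
    rw [Int.even_iff] at *
    omega

open Classical in
/-- Replacing an arc `e` into `w` and an arc `g` out of `w` by one arc. -/
lemma ParitySolvable.of_split {V : Finset α} {E : Finset β} {t h : β → α} {s : β → ℤ}
    {lb ub : α → ℤ} {e g : β} (he : e ∈ E) (hg : g ∈ E) (hge : g ≠ e) (hgt : t g = h e)
    (H : ParitySolvable V (E.erase g) t (Function.update h e (h g))
      (Function.update s e (s e + s g + 1))
      (fun v => lb v - if h e = v then 1 else 0) (fun v => ub v - if h e = v then 1 else 0)) :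
    ParitySolvable V E t h s lb ub := by
  obtain ⟨x, y, hxy, hv⟩ := H
  have heg : e ∈ E.erase g := Finset.mem_erase.2 ⟨hge.symm, he⟩
  obtain ⟨hx, hy, hs⟩ := hxy e heg
  -- The head value of the merged arc passes to `g`. The values `b` and `1 - b` at the middle vertex
  -- always add up to 1 there, and the `+ 1` in the merged parity is what makes the parity at `g`
  -- correct.
  obtain ⟨b, hb, hbs⟩ := exists_parity (s e - x e)
  simp only [Function.update_self] at hs
  refine ⟨Function.update x g (1 - b), Function.update (Function.update y e b) g (y e), ?_, ?_⟩
  · intro f hf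
    by_cases hfg : f = g
    · subst hfg
      simp only [Function.update_self]
      refine ⟨by omega, hy, ?_⟩
      rw [Int.even_iff] at *
      omega
    · by_cases hfe : f = e
      · subst hfe
        simp only [Function.update_of_ne hfg, Function.update_self]
        refine ⟨hx, hb, ?_⟩
        rw [Int.even_iff] at *
        omega
      · simpa [hfg, hfe] using hxy f (Finset.mem_erase.2 ⟨hfg, hf⟩)
  · intro v hvV
    have h1 : endSum E t (Function.update x g (1 - b)) v =
        endSum (E.erase g) t x v + if h e = v then 1 - b else 0 := by
      rw [endSum_erase hg, hgt]
      congr 1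
      · exact endSum_congr (fun _ _ => rfl)
          (fun f hf => by simp [Finset.ne_of_mem_erase hf]) v
      · simp
    have h2 : endSum E h (Function.update (Function.update y e b) g (y e)) v =
        endSum (E.erase g) (Function.update h e (h g)) y v + if h e = v then b else 0 := by
      rw [endSum_erase hg, endSum_erase heg, endSum_erase heg (Function.update h e (h g))]
      rw [endSum_congr (q := Function.update h e (h g)) (y := y)]
      · simp [hge.symm]
        ring
      · exact fun f hf => by simp [Finset.ne_of_mem_erase hf]
      · exact fun f hf => by
          simp [Finset.ne_of_mem_erase hf, Finset.ne_of_mem_erase (Finset.mem_of_mem_erase hf)]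
    obtain ⟨h3, h4, h5⟩ := hv v hvV
    rw [h1, h2]
    beta_reduce at h3 h4 h5
    split_ifs at h3 h4 h5 ⊢ with hev
    · refine ⟨by linarith, by linarith, ?_⟩
      convert h5 using 1
      ring
    · refine ⟨by linarith, by linarith, ?_⟩
      convert h5 using 1
      ring

-- A walk that used `g` can instead go to `t e` by arcs other than `e` and `g`, and follow the
-- merged arc to `h g`; all other arcs of `E.erase e` survive.
open Classical in
lemma Spans.split {V : Finset α} {E : Finset β} {t h : β → α} {z : α} {e g : β}
    (hsp : Spans V (E.erase e) t h z) (he : e ∈ E) (hge : g ≠ e)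
    (hu : ReflTransGen (Step ((E.erase e).erase g) t h) z (t e)) :
    Spans V (E.erase g) t (Function.update h e (h g)) z := by
  have hsub : ∀ a b, Step ((E.erase e).erase g) t h a b →
      Step (E.erase g) t (Function.update h e (h g)) a b := by
    rintro a b ⟨f, hf, rfl, rfl⟩
    simp only [Finset.mem_erase] at hf
    exact ⟨f, by simp [hf], rfl, by simp [hf]⟩
  have hu' := ReflTransGen.mono (p := Step (E.erase g) t (Function.update h e (h g))) hsub _ _ hu
  have key : ∀ v, ReflTransGen (Step (E.erase e) t h) z v →
      ReflTransGen (Step (E.erase g) t (Function.update h e (h g))) z v := by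
    intro v hv
    induction hv with
    | refl => exact .refl
    | tail hab hbc ih =>
      obtain ⟨f, hf, rfl, rfl⟩ := hbc
      by_cases hfg : f = g
      · subst hfg
        exact hu'.tail ⟨e, by simp [hge.symm, he], rfl, by simp⟩
      · simp only [Finset.mem_erase] at hf
        exact ih.tail ⟨f, by simp [hf, hfg], rfl, by simp [hf]⟩
  exact fun v hv => key v (hsp v hv)

-- Only the middle vertex `h e` is affected: it loses one incoming and one outgoing arc, while both
-- bounds drop by 1. At `h g` the merged arc replaces `g`.
open Classical in
lemma ParityBounds.split {V : Finset α} {E : Finset β} {t h : β → α} {z : α} {s : β → ℤ}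
    {lb ub : α → ℤ} (H : ParityBounds V E t h z s lb ub) {e g : β} (he : e ∈ E) (hg : g ∈ E)
    (hge : g ≠ e) (hgt : t g = h e) (hsp : Spans V (E.erase e) t h z)
    (hu : ReflTransGen (Step ((E.erase e).erase g) t h) z (t e)) :
    ParityBounds V (E.erase g) t (Function.update h e (h g)) z
      (Function.update s e (s e + s g + 1))
      (fun v => lb v - if h e = v then 1 else 0) (fun v => ub v - if h e = v then 1 else 0) where
  root_mem := H.root_mem
  tail_mem f hf := H.tail_mem f (Finset.mem_of_mem_erase hf)
  head_mem f hf := by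
    by_cases hfe : f = e
    · subst hfe
      simpa using H.head_mem g hg
    · simpa [hfe] using H.head_mem f (Finset.mem_of_mem_erase hf)
  spans := hsp.split he hge hu
  le v hv := by have := H.le v hv; linarith
  even_sub v hv := by
    have := H.even_sub v hv
    convert this using 1
    ring
  lb_le v hv := by
    have heg : e ∈ E.erase g := Finset.mem_erase.2 ⟨hge.symm, he⟩
    have h1 := H.lb_le v hv
    have h2 : endSum E h 1 v = endSum (E.erase g) (Function.update h e (h g)) 1 v +
        if h e = v then 1 else 0 := by
      rw [endSum_erase hg, endSum_erase heg, endSum_erase heg (Function.update h e (h g))]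
      rw [endSum_congr (q := Function.update h e (h g)) (y := 1)]
      · simp
        ring
      · exact fun f hf => by simp [Finset.ne_of_mem_erase hf]
      · exact fun f hf => rfl
    linarith
  le_ub v hv := by
    have h1 := H.le_ub v hv
    rw [endSum_erase hg, hgt, Pi.one_apply] at h1
    linarith
  even_sum := by
    have heg : e ∈ E.erase g := Finset.mem_erase.2 ⟨hge.symm, he⟩
    have h1 := H.even_sum
    rw [← Finset.sum_erase_add _ _ hg, ← Finset.sum_erase_add _ _ heg] at h1
    have h2 : ∑ f ∈ (E.erase g).erase e, Function.update s e (s e + s g + 1) f =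
        ∑ f ∈ (E.erase g).erase e, s f :=
      Finset.sum_congr rfl fun f hf => by simp [Finset.ne_of_mem_erase hf]
    rw [← Finset.sum_erase_add _ _ heg, Finset.sum_sub_distrib, Finset.sum_ite_eq,
      if_pos (H.head_mem e he), Function.update_self, h2]
    rw [Int.even_iff] at *
    omega

/-! ### Reachability after deleting an arc, and the induction -/

open Classical in
/-- A reachable vertex `w` is reachable without using arcs that leave `w`. -/
lemma reach_avoiding {D : Finset β} {t h : β → α} {z v : α} (w : α)
    (hv : ReflTransGen (Step D t h) z v) :
    ReflTransGen (Step (D.filter (t · ≠ w)) t h) z v ∨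
      ReflTransGen (Step (D.filter (t · ≠ w)) t h) z w := by
  induction hv with
  | refl => exact .inl .refl
  | tail hab hbc ih =>
    obtain ⟨f, hf, rfl, rfl⟩ := hbc
    rcases ih with ih | ih
    · by_cases hw : t f = w
      · exact .inr (hw ▸ ih)
      · exact .inl (ih.tail ⟨f, by simp [hf, hw], rfl, rfl⟩)
    · exact .inr ih

-- A walk stopped at its first visit to `t g` uses no arc leaving `t g`.
open Classical in
lemma reach_erase_self {D : Finset β} {t h : β → α} {z : α} {g : β}
    (hw : ReflTransGen (Step D t h) z (t g)) : ReflTransGen (Step (D.erase g) t h) z (t g) := by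
  refine ReflTransGen.mono (fun a b => Step.mono ?_) _ _ ((reach_avoiding (t g) hw).elim id id)
  intro f hf
  simp only [Finset.mem_filter] at hf
  exact Finset.mem_erase.2 ⟨fun hfg => hf.2 (hfg ▸ rfl), hf.1⟩

open Classical in
/-- Of two arcs with the same tail, one can be deleted without losing a given reachable vertex. -/
lemma reach_erase_or {D : Finset β} {t h : β → α} {z u : α} {g₁ g₂ : β}
    (ht : t g₁ = t g₂) (hg : g₁ ≠ g₂) (hu : ReflTransGen (Step D t h) z u) :
    ReflTransGen (Step (D.erase g₁) t h) z u ∨ ReflTransGen (Step (D.erase g₂) t h) z u := by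
  induction hu with
  | refl => exact .inl .refl
  | tail hab hbc ih =>
    obtain ⟨f, hf, rfl, rfl⟩ := hbc
    -- If the final arc `f` leaves the common tail, the tail can be reached without either arc, so
    -- one of the two that differs from `f` can be deleted.
    by_cases hft : t f = t g₁
    · by_cases hf1 : f = g₁
      · subst hf1
        refine .inr (ReflTransGen.tail (b := t g₂) (reach_erase_self (ht ▸ hab)) ?_)
        exact ⟨f, by simp [hg, hf], ht, rfl⟩
      · refine .inl (ReflTransGen.tail (b := t g₁) (reach_erase_self (hft ▸ hab)) ?_)
        exact ⟨f, by simp [hf1, hf], hft, rfl⟩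
    · have h1 : f ≠ g₁ := fun h => hft (h ▸ rfl)
      have h2 : f ≠ g₂ := fun h => hft (h ▸ ht.symm)
      exact ih.imp (fun h => h.tail ⟨f, by simp [hf, h1], rfl, rfl⟩)
        (fun h => h.tail ⟨f, by simp [hf, h2], rfl, rfl⟩)

open Classical in
lemma endSum_one (E : Finset β) (p : β → α) (v : α) :
    endSum E p 1 v = ((E.filter (p · = v)).card : ℤ) := by
  simp [endSum]

lemma one_le_endSum_one {E : Finset β} {p : β → α} {e : β} (he : e ∈ E) :
    1 ≤ endSum E p 1 (p e) := by
  classical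
  rw [endSum_one]
  exact_mod_cast Finset.card_pos.2 ⟨e, by simp [he]⟩

lemma one_le_indeg_of_spans {V : Finset α} {E : Finset β} {t h : β → α} {z v : α}
    (hsp : Spans V E t h z) (hv : v ∈ V) (hvz : v ≠ z) : 1 ≤ endSum E h 1 v := by
  rcases (hsp v hv).cases_tail with h1 | ⟨b, -, f, hf, rfl, rfl⟩
  · exact absurd h1 hvz
  · exact one_le_endSum_one hf

open Classical in
/-- A removable arc allows a reduction to data with fewer arcs. -/
lemma ParityBounds.solvable_of_removable {V : Finset α} {E : Finset β} {t h : β → α} {z : α}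
    {s : β → ℤ} {lb ub : α → ℤ} (H : ParityBounds V E t h z s lb ub) {e : β} (he : e ∈ E)
    (hsp : Spans V (E.erase e) t h z)
    (ih : ∀ (E' : Finset β) (h' : β → α) (s' : β → ℤ) (lb' ub' : α → ℤ), E'.card < E.card →
      ParityBounds V E' t h' z s' lb' ub' → ParitySolvable V E' t h' s' lb' ub') :
    ParitySolvable V E t h s lb ub := by
  by_cases hdel : ∃ b : ℤ,
      (b = 0 ∧ lb (h e) < endSum E h 1 (h e) + if h e = z then 1 else 0) ∨
      (b = 1 ∧ endSum E t 1 (h e) - (if h e = z then 1 else 0) < ub (h e))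
  · obtain ⟨b, hb⟩ := hdel
    obtain ⟨a, ha, hab⟩ := exists_parity (s e - b)
    have hab' : Even (a + b - s e) := by convert hab using 1; ring
    exact .of_erase he ha (by omega) hab'
      (ih _ _ _ _ _ (Finset.card_erase_lt_of_mem he) (H.erase he hsp ha hab' hb))
  · push Not at hdel
    -- Without slack at `w = h e`, in-degree ≤ `lb w` ≤ `ub w` ≤ out-degree, with an extra gap of 2
    -- if `w = z`. The in-degree is at least 1, and at least 2 if `w ≠ z`, because `w` is also
    -- reached without `e`. Hence the out-degree is at least 2.
    have h0 := (hdel 0).1 rfl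
    have h1 := (hdel 1).2 rfl
    have h2 := H.le _ (H.head_mem e he)
    have h3 : 1 + (if h e = z then 0 else 1) ≤ endSum E h 1 (h e) := by
      rw [endSum_erase he, if_pos rfl, Pi.one_apply]
      split_ifs with hz
      · have : 0 ≤ endSum (E.erase e) h 1 (h e) := endSum_nonneg (fun _ _ => zero_le_one) _
        simpa using this
      · have := one_le_indeg_of_spans hsp (H.head_mem e he) hz
        omega
    have h4 : 2 ≤ endSum E t 1 (h e) := by split_ifs at * <;> omega
    obtain ⟨g, hg, hgt, hu⟩ : ∃ g ∈ E.erase e, t g = h e ∧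
        ReflTransGen (Step ((E.erase e).erase g) t h) z (t e) := by
      rw [endSum_erase he, endSum_one] at h4
      -- A loop `e` is itself one of the outgoing arcs, so only one other is guaranteed; but its
      -- tail is then `t e`, which is reachable without it. If `e` is not a loop, there are two
      -- candidates, and one of them is dispensable for reaching `t e`.
      by_cases hloop : t e = h e
      · have : 0 < ((E.erase e).filter (t · = h e)).card := by
          rw [if_pos hloop, Pi.one_apply] at h4
          omega
        obtain ⟨g, hg⟩ := Finset.card_pos.1 this
        simp only [Finset.mem_filter] at hg
        refine ⟨g, hg.1, hg.2, ?_⟩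
        have := hsp _ (H.tail_mem e he)
        rw [hloop, ← hg.2] at this ⊢
        exact reach_erase_self this
      · have : 1 < ((E.erase e).filter (t · = h e)).card := by
          rw [if_neg hloop] at h4
          omega
        obtain ⟨g₁, hg₁, g₂, hg₂, hne⟩ := Finset.one_lt_card.1 this
        simp only [Finset.mem_filter] at hg₁ hg₂
        rcases reach_erase_or (hg₁.2.trans hg₂.2.symm) hne (hsp _ (H.tail_mem e he)) with hr | hr
        · exact ⟨g₁, hg₁.1, hg₁.2, hr⟩
        · exact ⟨g₂, hg₂.1, hg₂.2, hr⟩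
    have hge := Finset.ne_of_mem_erase hg
    have hgE := Finset.mem_of_mem_erase hg
    exact .of_split he hgE hge hgt
      (ih _ _ _ _ _ (Finset.card_erase_lt_of_mem hgE) (H.split he hgE hge hgt hsp hu))

open Classical in
/-- If the only arc at `y ≠ z` is `e`, then `y` and `e` can be deleted. -/
lemma ParityBounds.solvable_of_pendant {V : Finset α} {E : Finset β} {t h : β → α} {z y : α}
    {s : β → ℤ} {lb ub : α → ℤ} (H : ParityBounds V E t h z s lb ub) {e : β} (he : e ∈ E)
    (hy : h e = y) (hyz : y ≠ z) (hty : t e ≠ y)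
    (honly : ∀ f ∈ E, f ≠ e → t f ≠ y ∧ h f ≠ y)
    (ih : ∀ (s' : β → ℤ) (lb' ub' : α → ℤ), ParityBounds (V.erase y) (E.erase e) t h z s' lb' ub' →
      ParitySolvable (V.erase y) (E.erase e) t h s' lb' ub') :
    ParitySolvable V E t h s lb ub := by
  have hyV : y ∈ V := hy ▸ H.head_mem e he
  have hzero (x : β → ℤ) : endSum (E.erase e) t x y = 0 ∧ endSum (E.erase e) h x y = 0 := by
    constructor <;> refine Finset.sum_eq_zero fun f hf => if_neg ?_
    · exact (honly f (Finset.mem_of_mem_erase hf) (Finset.ne_of_mem_erase hf)).1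
    · exact (honly f (Finset.mem_of_mem_erase hf) (Finset.ne_of_mem_erase hf)).2
  have h1 := H.lb_le y hyV
  have h2 := H.le_ub y hyV
  rw [endSum_erase he, (hzero 1).2, if_pos hy, if_neg hyz, Pi.one_apply] at h1
  rw [endSum_erase he, (hzero 1).1, if_neg hty, if_neg hyz] at h2
  obtain ⟨b, hb, hbl⟩ := exists_parity (lb y)
  have h3 := H.le y hyV
  have h4 := H.even_sub y hyV
  -- Here `lb y ≤ 1` and `0 ≤ ub y`, so the element of {0, 1} with the common parity of both bounds
  -- lies between them.
  have hlb : lb y ≤ b := by rw [Int.even_iff] at *; omega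
  have hub : b ≤ ub y := by rw [Int.even_iff] at *; omega
  obtain ⟨a, ha, hab⟩ := exists_parity (s e - b)
  have hab' : Even (a + b - s e) := by convert hab using 1; ring
  refine .of_erase he ha hb hab' ?_
  have key : ∀ v, ReflTransGen (Step E t h) z v → v ≠ y →
      ReflTransGen (Step (E.erase e) t h) z v := by
    intro v hv
    induction hv with
    | refl => exact fun _ => .refl
    | tail hbv hbc ih =>
      obtain ⟨f, hf, rfl, rfl⟩ := hbc
      intro hfy
      have hfe : f ≠ e := fun h => hfy (h ▸ hy)
      exact (ih (honly f hf hfe).1).tail ⟨f, by simp [hf, hfe], rfl, rfl⟩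
  obtain ⟨x, w, hxw, hv⟩ := ih s
    (fun v => lb v - (if t e = v then a else 0) - (if h e = v then b else 0))
    (fun v => ub v - (if t e = v then a else 0) - (if h e = v then b else 0))
    { root_mem := Finset.mem_erase.2 ⟨hyz.symm, H.root_mem⟩
      tail_mem := fun f hf => by
        have := Finset.mem_erase.1 hf
        exact Finset.mem_erase.2 ⟨(honly f this.2 this.1).1, H.tail_mem f this.2⟩
      head_mem := fun f hf => by
        have := Finset.mem_erase.1 hf
        exact Finset.mem_erase.2 ⟨(honly f this.2 this.1).2, H.head_mem f this.2⟩
      spans := fun v hv =>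
        key v (H.spans v (Finset.mem_of_mem_erase hv)) (Finset.ne_of_mem_erase hv)
      le := fun v hv => by
        have := H.le v (Finset.mem_of_mem_erase hv)
        linarith
      even_sub := fun v hv => by
        convert H.even_sub v (Finset.mem_of_mem_erase hv) using 1
        ring
      lb_le := fun v hv => by
        have h1 := H.lb_le v (Finset.mem_of_mem_erase hv)
        have hev : h e ≠ v := fun h => Finset.ne_of_mem_erase hv (h ▸ hy)
        rw [endSum_erase he, if_neg hev] at h1
        rw [if_neg hev]
        have : 0 ≤ if t e = v then a else 0 := by split_ifs <;> omega
        linarith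
      le_ub := fun v hv => by
        have h1 := H.le_ub v (Finset.mem_of_mem_erase hv)
        have hev : h e ≠ v := fun h => Finset.ne_of_mem_erase hv (h ▸ hy)
        rw [endSum_erase he, Pi.one_apply] at h1
        rw [if_neg hev]
        have : (if t e = v then a else 0) ≤ if t e = v then 1 else 0 := by split_ifs <;> omega
        linarith
      even_sum := by
        have h1 := H.even_sum
        rw [← Finset.sum_erase_add _ _ he, ← Finset.sum_erase_add _ _ hyV] at h1
        have h2 : ∑ v ∈ V.erase y,
            (lb v - (if t e = v then a else 0) - (if h e = v then b else 0)) =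
            ∑ v ∈ V.erase y, lb v - a := by
          rw [Finset.sum_sub_distrib, Finset.sum_sub_distrib, Finset.sum_ite_eq,
            Finset.sum_ite_eq, if_pos (Finset.mem_erase.2 ⟨hty, H.tail_mem e he⟩),
            if_neg (by simp [hy]), sub_zero]
        rw [h2]
        rw [Int.even_iff] at *
        omega }
  refine ⟨x, w, hxw, fun v hvV => ?_⟩
  by_cases hvy : v = y
  · subst hvy
    beta_reduce
    rw [(hzero x).1, (hzero w).2, if_neg hty, if_pos hy]
    refine ⟨by omega, by omega, ?_⟩
    convert hbl using 1
    ring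
  · exact hv v (Finset.mem_erase.2 ⟨hvy, hvV⟩)

open Classical in
/-- A spanning family of arcs on at least two vertices has a vertex `y`, not the root, such that all
other vertices are reached without passing through `y`. -/
lemma Spans.exists_last {V : Finset α} {E : Finset β} {t h : β → α} {z : α}
    (hsp : Spans V E t h z) (hz : z ∈ V) (hV : V ≠ {z}) (hh : ∀ e ∈ E, h e ∈ V) :
    ∃ y ∈ V, y ≠ z ∧ (∀ v ∈ V, v ≠ y →
        ReflTransGen (Step (E.filter fun e => t e ≠ y ∧ h e ≠ y) t h) z v) ∧
      ∃ e ∈ E, t e ≠ y ∧ h e = y := by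
  -- Take a largest proper subset `U` that is reached from `z` inside itself. Some arc leaves it,
  -- and by maximality adding the head of this arc gives all of `V`; that head is the vertex sought.
  let P : Finset α → Prop := fun U => z ∈ U ∧ U ⊆ V ∧ U ≠ V ∧
    ∀ v ∈ U, ReflTransGen (Step (E.filter fun e => t e ∈ U ∧ h e ∈ U) t h) z v
  have hP : ({z} : Finset α) ∈ V.powerset.filter P := by
    simp only [Finset.mem_filter, Finset.mem_powerset, P]
    refine ⟨by simpa using hz, by simp, by simpa using hz, hV.symm, ?_⟩
    intro v hv
    rw [Finset.mem_singleton.1 hv]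
  obtain ⟨U, hU, hmax⟩ := Finset.exists_max_image (V.powerset.filter P) Finset.card ⟨_, hP⟩
  obtain ⟨-, hzU, hUV, hUne, hreach⟩ := Finset.mem_filter.1 hU
  obtain ⟨e, heE, hte, hhe⟩ : ∃ e ∈ E, t e ∈ U ∧ h e ∉ U := by
    by_contra! hcon
    refine hUne (hUV.antisymm fun v hv => ?_)
    have := hsp v hv
    clear hv
    induction this with
    | refl => exact hzU
    | tail _ hbc ih =>
      obtain ⟨f, hf, rfl, rfl⟩ := hbc
      exact hcon f hf ih
  have hins : insert (h e) U = V := by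
    by_contra hne
    have hmono : ∀ a b, Step (E.filter fun e => t e ∈ U ∧ h e ∈ U) t h a b →
        Step (E.filter fun f => t f ∈ insert (h e) U ∧ h f ∈ insert (h e) U) t h a b := by
      refine fun a b => Step.mono fun f hf => ?_
      simp only [Finset.mem_filter, Finset.mem_insert] at hf ⊢
      tauto
    have hmem : insert (h e) U ∈ V.powerset.filter P := by
      have hsub : insert (h e) U ⊆ V := Finset.insert_subset (hh e heE) hUV
      refine Finset.mem_filter.2 ⟨Finset.mem_powerset.2 hsub, Finset.mem_insert_of_mem hzU, hsub,
        hne, fun v hv => ?_⟩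
      rcases Finset.mem_insert.1 hv with rfl | hv
      · exact (ReflTransGen.mono hmono _ _ (hreach _ hte)).tail ⟨e, by simp [heE, hte], rfl, rfl⟩
      · exact ReflTransGen.mono hmono _ _ (hreach v hv)
    have := hmax _ hmem
    rw [Finset.card_insert_of_notMem hhe] at this
    omega
  refine ⟨h e, hh e heE, fun hez => hhe (hez ▸ hzU), fun v hv hvy => ?_, e, heE,
    fun hth => hhe (hth ▸ hte), rfl⟩
  have hvU : v ∈ U := (Finset.mem_insert.1 (hins ▸ hv)).resolve_left hvy
  refine ReflTransGen.mono (fun a b => Step.mono fun f hf => ?_) _ _ (hreach v hvU)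
  simp only [Finset.mem_filter] at hf ⊢
  exact ⟨hf.1, fun h => hhe (h ▸ hf.2.1), fun h => hhe (h ▸ hf.2.2)⟩

theorem ParityBounds.solvable {V : Finset α} {E : Finset β} {t h : β → α} {z : α}
    {s : β → ℤ} {lb ub : α → ℤ} (H : ParityBounds V E t h z s lb ub) :
    ParitySolvable V E t h s lb ub := by
  classical
  induction hn : V.card + E.card using Nat.strong_induction_on generalizing V E h s lb ub with
  | _ n ih =>
  have red : ∀ e ∈ E, Spans V (E.erase e) t h z → ParitySolvable V E t h s lb ub :=
    fun e he hsp => H.solvable_of_removable he hsp fun E' h' s' lb' ub' hlt H' =>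
      ih _ (by omega) H' rfl
  by_cases hV : V = {z}
  · subst hV
    rcases E.eq_empty_or_nonempty with rfl | ⟨e, he⟩
    · refine ⟨0, 0, by simp, fun v hv => ?_⟩
      -- The slack at the root is absorbed by parity: `lb z ≤ 1` and `-1 ≤ ub z`, and both bounds
      -- are even, so 0 lies between them.
      have h1 := H.lb_le v hv
      have h2 := H.le_ub v hv
      have h3 := H.le v hv
      have h4 := H.even_sub v hv
      have h5 := H.even_sum
      obtain rfl := Finset.mem_singleton.1 hv
      simp only [endSum, Finset.sum_empty, Finset.sum_singleton, if_true] at *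
      rw [Int.even_iff] at *
      omega
    · refine red e he fun v hv => ?_
      rw [Finset.mem_singleton.1 hv]
  · obtain ⟨y, hyV, hyz, hreach, e, he, hte, hhe⟩ := H.spans.exists_last H.root_mem hV H.head_mem
    by_cases hf : ∃ f ∈ E, f ≠ e ∧ (t f = y ∨ h f = y)
    · obtain ⟨f, hfE, hfe, hfy⟩ := hf
      -- Arcs avoiding `y` reach all other vertices, and `e` reaches `y`; a further arc `f` at `y`
      -- is therefore removable.
      refine red f hfE fun v hv => ?_
      have hsub : E.filter (fun e => t e ≠ y ∧ h e ≠ y) ⊆ E.erase f := by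
        intro g hg
        simp only [Finset.mem_filter] at hg
        refine Finset.mem_erase.2 ⟨?_, hg.1⟩
        rintro rfl
        tauto
      by_cases hvy : v = y
      · subst hvy
        exact (ReflTransGen.mono (fun a b => Step.mono hsub) _ _
          (hreach _ (H.tail_mem e he) hte)).tail ⟨e, by simp [he, hfe.symm], rfl, hhe⟩
      · exact ReflTransGen.mono (fun a b => Step.mono hsub) _ _ (hreach v hv hvy)
    · push Not at hf
      refine H.solvable_of_pendant he hhe hyz hte (fun f hfE hfe => hf f hfE hfe) ?_
      intro s' lb' ub' H'
      refine ih _ ?_ H' rfl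
      have := Finset.card_erase_lt_of_mem hyV
      have := Finset.card_erase_lt_of_mem he
      omega

/-! ### Orientations with prescribed in-degrees -/

open Classical in
/-- The number of arcs of `E` whose end `p e` is in `X`. -/
noncomputable def endCount (E : Finset β) (p : β → α) (X : Finset α) : ℕ :=
  (E.filter (p · ∈ X)).card

open Classical in
/-- The number of arcs of `E` with both ends in `X`. -/
noncomputable def inner (E : Finset β) (a b : β → α) (X : Finset α) : ℕ :=
  (E.filter fun e => a e ∈ X ∧ b e ∈ X).card

open Classical in
/-- The number of arcs of `E` from the complement of `X` to `X`. -/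
noncomputable def inCut (E : Finset β) (t h : β → α) (X : Finset α) : ℕ :=
  (E.filter fun e => t e ∉ X ∧ h e ∈ X).card

open Classical in
lemma sum_endCount (E : Finset β) (p : β → α) (X : Finset α) :
    ∑ v ∈ X, endCount E p {v} = endCount E p X := by
  unfold endCount
  rw [Finset.card_eq_sum_card_fiberwise (f := p) (t := X)
    fun e he => by simpa using (Finset.mem_filter.1 he).2]
  refine Finset.sum_congr rfl fun v hv => ?_
  congr 1
  ext e
  simp only [Finset.mem_filter, Finset.mem_singleton]
  constructor
  · rintro ⟨h1, rfl⟩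
    exact ⟨⟨h1, hv⟩, rfl⟩
  · tauto

lemma endCount_eq_inner_add_inCut (E : Finset β) (t h : β → α) (X : Finset α) :
    endCount E h X = inner E t h X + inCut E t h X := by
  classical
  unfold endCount inner inCut
  rw [← Finset.card_union_of_disjoint]
  · congr 1
    ext e
    simp only [Finset.mem_filter, Finset.mem_union]
    tauto
  · rw [Finset.disjoint_filter]
    tauto

lemma inner_comm (E : Finset β) (t h : β → α) (X : Finset α) : inner E t h X = inner E h t X := by
  unfold inner
  congr 1
  ext e
  simp only [Finset.mem_filter]
  tauto

lemma inner_supermodular [DecidableEq α] (E : Finset β) (a b : β → α) (X Y : Finset α) :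
    inner E a b X + inner E a b Y ≤ inner E a b (X ∪ Y) + inner E a b (X ∩ Y) := by
  classical
  unfold inner
  rw [← Finset.card_union_add_card_inter]
  refine add_le_add (Finset.card_le_card fun e => ?_) (Finset.card_le_card fun e => ?_)
  · simp only [Finset.mem_filter, Finset.mem_union]
    tauto
  · simp only [Finset.mem_filter, Finset.mem_inter]
    tauto

open Classical in
/-- Hakimi's theorem: a graph has an orientation with in-degrees `μ` if the sum of `μ` over every
set of vertices is at least the number of edges inside, with equality for the set of all
vertices. -/
theorem exists_orientation_of_inner_le {V : Finset α} {E : Finset β} {a b : β → α} {μ : α → ℕ}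
    (ha : ∀ e ∈ E, a e ∈ V) (hb : ∀ e ∈ E, b e ∈ V)
    (hμ : ∀ X ⊆ V, inner E a b X ≤ ∑ v ∈ X, μ v) (hV : ∑ v ∈ V, μ v = E.card) :
    ∃ t h : β → α, (∀ e ∈ E, (t e = a e ∧ h e = b e) ∨ (t e = b e ∧ h e = a e)) ∧
      ∀ v ∈ V, endCount E h {v} = μ v := by
  -- Hall's theorem: each edge is matched to one of the `μ v` slots at an end `v`, which becomes its
  -- head. For a set of edges with set of ends `X`, the slots number `μ(X)`, at least the number of
  -- edges inside `X`.
  obtain ⟨f, hf, hfm⟩ := (Finset.all_card_le_biUnion_card_iff_exists_injective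
    (fun e : E => (({a e, b e} : Finset α).sigma fun v => Finset.range (μ v)))).1 <| by
      intro s
      let X : Finset α := s.biUnion fun e => {a e, b e}
      have hX : (s.biUnion fun e : E => (({a e, b e} : Finset α).sigma
          fun v => Finset.range (μ v))) = X.sigma fun v => Finset.range (μ v) := by
        ext ⟨v, j⟩
        simp only [Finset.mem_biUnion, Finset.mem_sigma, X]
        constructor
        · rintro ⟨e, he, hv, hj⟩
          exact ⟨⟨e, he, hv⟩, hj⟩
        · rintro ⟨⟨e, he, hv⟩, hj⟩
          exact ⟨e, he, hv, hj⟩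
      rw [hX, Finset.card_sigma]
      simp only [Finset.card_range]
      refine le_trans ?_ (hμ X ?_)
      · rw [← Finset.card_map (Function.Embedding.subtype _)]
        refine Finset.card_le_card fun e he => ?_
        simp only [Finset.mem_map, Function.Embedding.subtype_apply] at he
        obtain ⟨e, he, rfl⟩ := he
        simp only [Finset.mem_filter, X, Finset.mem_biUnion]
        exact ⟨e.2, ⟨e, he, by simp⟩, ⟨e, he, by simp⟩⟩
      · intro v hv
        simp only [X, Finset.mem_biUnion, Finset.mem_insert, Finset.mem_singleton] at hv
        obtain ⟨e, -, rfl | rfl⟩ := hv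
        · exact ha _ e.2
        · exact hb _ e.2
  let h : β → α := fun e => if he : e ∈ E then (f ⟨e, he⟩).1 else a e
  have hh : ∀ e ∈ E, h e = a e ∨ h e = b e := by
    intro e he
    have := hfm ⟨e, he⟩
    simp only [Finset.mem_sigma, Finset.mem_insert, Finset.mem_singleton] at this
    simpa [h, he] using this.1
  refine ⟨fun e => if h e = a e then b e else a e, h, ?_, ?_⟩
  · intro e he
    by_cases hea : h e = a e
    · simp [hea]
    · simp [(hh e he).resolve_left hea]
  -- Injectivity on slots bounds each in-degree by `μ`; equality of the totals then forces equality
  -- everywhere.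
  · have hle : ∀ v ∈ V, endCount E h {v} ≤ μ v := by
      intro v hv
      have : endCount E h {v} ≤ (Finset.range (μ v)).card := by
        refine Finset.card_le_card_of_injOn (fun e => if he : e ∈ E then (f ⟨e, he⟩).2 else 0) ?_ ?_
        · intro e he
          simp only [Finset.coe_filter, Finset.mem_singleton, Set.mem_ofPred_eq] at he
          have h1 := hfm ⟨e, he.1⟩
          have h2 : (f ⟨e, he.1⟩).1 = v := by simpa [h, he.1] using he.2
          simp only [Finset.mem_sigma] at h1
          simpa [he.1, h2] using h1.2
        · intro e he e' he' hee
          simp only [Finset.coe_filter, Finset.mem_singleton, Set.mem_ofPred_eq] at he he'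
          have h2 : (f ⟨e, he.1⟩).1 = v := by simpa [h, he.1] using he.2
          have h3 : (f ⟨e', he'.1⟩).1 = v := by simpa [h, he'.1] using he'.2
          simp only [he.1, he'.1, dif_pos] at hee
          have := hf (Sigma.ext (h2.trans h3.symm) (heq_of_eq hee))
          simpa using this
      simpa using this
    refine (Finset.sum_eq_sum_iff_of_le hle).1 ?_
    rw [sum_endCount, hV]
    unfold endCount
    rw [Finset.filter_true_of_mem]
    intro e he
    rcases hh e he with h1 | h1 <;> rw [h1]
    · exact ha e he
    · exact hb e he

/-- A sum over `W` is nonpositive if every element with a positive term lies in a member of a family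
of subsets with nonpositive sums which is closed under unions of intersecting members. -/
lemma sum_nonpos_of_cover [DecidableEq α] {ε : α → ℤ} (W : Finset α) (F : Finset α → Prop)
    (hsub : ∀ X, F X → X ⊆ W) (hsum : ∀ X, F X → ∑ v ∈ X, ε v ≤ 0)
    (hunion : ∀ X Y, F X → F Y → (X ∩ Y).Nonempty → F (X ∪ Y))
    (hcov : ∀ v ∈ W, ε v ≤ 0 ∨ ∃ X, F X ∧ v ∈ X) : ∑ v ∈ W, ε v ≤ 0 := by
  classical
  induction W using Finset.strongInduction generalizing F with
  | H W ih =>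
  by_cases hF : ∃ X, F X ∧ X.Nonempty
  · obtain ⟨X₀, hX₀, hne₀⟩ := hF
    -- A largest member absorbs every member that meets it, so it can be split off and induction
    -- applied to `W \ X` with the members disjoint from `X`.
    obtain ⟨X, hX, hmax⟩ := Finset.exists_max_image (W.powerset.filter F) Finset.card
      ⟨X₀, by simp [hX₀, hsub X₀ hX₀]⟩
    have hXF := (Finset.mem_filter.1 hX).2
    have hXne : X.Nonempty := by
      rw [← Finset.card_pos]
      exact (Finset.card_pos.2 hne₀).trans_le (hmax X₀ (by simp [hX₀, hsub X₀ hX₀]))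
    have hXW := hsub X hXF
    have habs : ∀ Y, F Y → (X ∩ Y).Nonempty → Y ⊆ X := by
      intro Y hY hXY
      have h1 := hunion X Y hXF hY hXY
      have h2 := Finset.eq_of_subset_of_card_le Finset.subset_union_left
        (hmax _ (by simp only [Finset.mem_filter, Finset.mem_powerset]; exact ⟨hsub _ h1, h1⟩))
      rw [h2]
      exact Finset.subset_union_right
    rw [← Finset.sum_sdiff hXW]
    refine add_nonpos (ih (W \ X) (Finset.sdiff_ssubset hXW hXne)
      (fun Y => F Y ∧ Disjoint X Y) ?_ (fun Y hY => hsum Y hY.1) ?_ ?_) (hsum X hXF)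
    · intro Y hY
      exact Finset.subset_sdiff.2 ⟨hsub Y hY.1, hY.2.symm⟩
    · intro Y Z hY hZ hYZ
      exact ⟨hunion Y Z hY.1 hZ.1 hYZ, Finset.disjoint_union_right.2 ⟨hY.2, hZ.2⟩⟩
    · intro v hv
      obtain ⟨hvW, hvX⟩ := Finset.mem_sdiff.1 hv
      refine (hcov v hvW).imp id ?_
      rintro ⟨Y, hY, hvY⟩
      refine ⟨Y, ⟨hY, ?_⟩, hvY⟩
      rw [Finset.disjoint_iff_inter_eq_empty, ← Finset.not_nonempty_iff_eq_empty]
      exact fun hXY => hvX (habs Y hY hXY hvY)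
  · refine Finset.sum_nonpos fun v hv => (hcov v hv).resolve_right ?_
    rintro ⟨X, hX, hvX⟩
    exact hF ⟨X, hX, v, hvX⟩

open Classical in
/-- If every nonempty set of vertices without `z` is left by at least `2 * k` edges, there is an
orientation in which it is entered by at least `k` arcs and the in-degrees are half of the degrees,
rounded down or up; at `z`, rounded up. -/
theorem exists_balanced_orientation {V : Finset α} {E : Finset β} {a b : β → α} {z : α} {k : ℕ}
    (ha : ∀ e ∈ E, a e ∈ V) (hb : ∀ e ∈ E, b e ∈ V) (hz : z ∈ V)
    (hcut : ∀ X ⊆ V, X.Nonempty → z ∉ X → 2 * k ≤ inCut E a b X + inCut E b a X) :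
    ∃ t h : β → α, (∀ e ∈ E, (t e = a e ∧ h e = b e) ∨ (t e = b e ∧ h e = a e)) ∧
      (∀ X ⊆ V, X.Nonempty → z ∉ X → k ≤ inCut E t h X) ∧
      (∀ v ∈ V, (endCount E a {v} + endCount E b {v}) / 2 ≤ endCount E h {v}) ∧
      (∀ v ∈ V, endCount E h {v} ≤ (endCount E a {v} + endCount E b {v} + 1) / 2) ∧
      endCount E h {z} = (endCount E a {z} + endCount E b {z} + 1) / 2 := by
  let d : α → ℕ := fun v => endCount E a {v} + endCount E b {v}
  have hd : ∀ X, ∑ v ∈ X, d v = 2 * inner E a b X + (inCut E a b X + inCut E b a X) := by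
    intro X
    simp only [d]
    rw [Finset.sum_add_distrib, sum_endCount, sum_endCount, endCount_eq_inner_add_inCut E a b,
      endCount_eq_inner_add_inCut E b a, inner_comm E b a]
    ring
  have hdV : ∑ v ∈ V, d v = 2 * E.card := by
    simp only [d]
    rw [Finset.sum_add_distrib, sum_endCount, sum_endCount]
    unfold endCount
    rw [Finset.filter_true_of_mem ha, Finset.filter_true_of_mem hb]
    ring
  let O : Finset α := V.filter fun v => v ≠ z ∧ d v % 2 = 1
  -- In-degrees start at half the degree rounded up and are rounded down on `A`, a largest set of
  -- odd vertices other than `z` for which the cut condition `P` survives.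
  let μ : Finset α → α → ℕ := fun A v => (d v + 1) / 2 - if v ∈ A then 1 else 0
  have hμ : ∀ A ⊆ O, ∀ v, d v ≤ 2 * μ A v + 1 ∧ 2 * μ A v ≤ d v + 1 ∧
      (v ∈ A → 2 * μ A v + 1 = d v) := by
    intro A hA v
    simp only [μ]
    split_ifs with hv
    · have := (Finset.mem_filter.1 (hA hv)).2.2
      exact ⟨by omega, by omega, fun _ => by omega⟩
    · exact ⟨by omega, by omega, fun h => absurd h hv⟩
  let p : Finset α → ℕ := fun X => if z ∈ X then 0 else k
  have hp : ∀ X ⊆ V, X.Nonempty → 2 * p X ≤ inCut E a b X + inCut E b a X := by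
    intro X hX hne
    simp only [p]
    split_ifs with hzX
    · simp
    · exact hcut X hX hne hzX
  let P : Finset α → Prop := fun A =>
    ∀ X ⊆ V, X.Nonempty → inner E a b X + p X ≤ ∑ v ∈ X, μ A v
  have hP : ∅ ∈ O.powerset.filter P := by
    have h0 : ∀ X, ∑ v ∈ X, d v ≤ 2 * ∑ v ∈ X, μ ∅ v := by
      intro X
      rw [Finset.mul_sum]
      refine Finset.sum_le_sum fun v _ => ?_
      simp only [μ, Finset.notMem_empty, if_false]
      omega
    refine Finset.mem_filter.2 ⟨by simp, fun X hX hne => ?_⟩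
    have := h0 X
    have := hd X
    have := hp X hX hne
    omega
  obtain ⟨A, hA, hmax⟩ := Finset.exists_max_image _ Finset.card ⟨_, hP⟩
  obtain ⟨hAO, hAX⟩ := Finset.mem_filter.1 hA
  rw [Finset.mem_powerset] at hAO
  have hAV : E.card ≤ ∑ v ∈ V, μ A v := by
    have h1 := hAX V subset_rfl ⟨z, hz⟩
    unfold inner at h1
    rw [Finset.filter_true_of_mem fun e he => ⟨ha e he, hb e he⟩] at h1
    omega
  have hsumV : ∑ v ∈ V, μ A v = E.card := by
    by_contra hne
    have hlt : E.card < ∑ v ∈ V, μ A v := lt_of_le_of_ne hAV (Ne.symm hne)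
    have hins : ∀ v ∈ O, v ∉ A → ∀ X, ∑ u ∈ X, μ A u =
        ∑ u ∈ X, μ (insert v A) u + if v ∈ X then 1 else 0 := by
      intro v hv hvA X
      rw [← Finset.sum_ite_eq' X v (fun _ => 1), ← Finset.sum_add_distrib]
      refine Finset.sum_congr rfl fun u _ => ?_
      simp only [μ, Finset.mem_insert]
      by_cases huv : u = v
      · subst huv
        have := (Finset.mem_filter.1 hv).2.2
        simp only [hvA, if_true, true_or, if_false]
        omega
      · simp [huv]
    let T : Finset α → Prop := fun X => X ⊆ V ∧ X.Nonempty ∧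
      inner E a b X + p X = ∑ v ∈ X, μ A v
    -- A positive term occurs only at an odd vertex other than `z` outside `A`. By maximality of `A`
    -- it lies in a tight set. On a tight set `2 * μ` sums to at most the degree sum, by the cut
    -- hypothesis, and intersecting tight sets have a tight union, since `inner` is supermodular and
    -- `p` modular. Summed over `V`, this leaves an excess of at most 1 in `2 * μ`, hence none in
    -- `μ`.
    have hkey : ∑ v ∈ V, ((2 * μ A v : ℤ) - d v - if v = z then 1 else 0) ≤ 0 := by
      refine sum_nonpos_of_cover _ T (fun X h => h.1) ?_ ?_ ?_
      · intro X hX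
        have h1 := hd X
        have h2 := hp X hX.1 hX.2.1
        have h3 := hX.2.2
        rw [Finset.sum_sub_distrib, Finset.sum_sub_distrib, ← Finset.mul_sum]
        have : 2 * ∑ v ∈ X, μ A v ≤ ∑ v ∈ X, d v := by omega
        have : (2 * ∑ v ∈ X, (μ A v : ℤ)) ≤ ∑ v ∈ X, (d v : ℤ) := by exact_mod_cast this
        have : 0 ≤ ∑ v ∈ X, if v = z then (1 : ℤ) else 0 :=
          Finset.sum_nonneg fun v _ => by split_ifs <;> simp
        linarith
      · intro X Y hX hY hXY
        refine ⟨Finset.union_subset hX.1 hY.1, hX.2.1.mono Finset.subset_union_left, ?_⟩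
        have h1 := inner_supermodular E a b X Y
        have h2 := hAX (X ∪ Y) (Finset.union_subset hX.1 hY.1)
          (hX.2.1.mono Finset.subset_union_left)
        have h3 := hAX (X ∩ Y) (Finset.inter_subset_left.trans hX.1) hXY
        have h4 := Finset.sum_union_inter (s₁ := X) (s₂ := Y) (f := μ A)
        have h5 := hX.2.2
        have h6 := hY.2.2
        have h7 : p X + p Y = p (X ∪ Y) + p (X ∩ Y) := by
          simp only [p, Finset.mem_union, Finset.mem_inter]
          by_cases hzX : z ∈ X <;> by_cases hzY : z ∈ Y <;> simp [hzX, hzY]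
        omega
      · intro v hv
        by_cases hvO : v ∈ O ∧ v ∉ A
        · right
          have hnot : insert v A ∉ O.powerset.filter P := by
            intro hmem
            have := hmax _ hmem
            rw [Finset.card_insert_of_notMem hvO.2] at this
            omega
          simp only [Finset.mem_filter, Finset.mem_powerset, P, not_and, not_forall] at hnot
          obtain ⟨X, hX, hne, hlt'⟩ := hnot (Finset.insert_subset hvO.1 hAO)
          have h1 := hins v hvO.1 hvO.2 X
          have h2 := hAX X hX hne
          refine ⟨X, ⟨hX, hne, ?_⟩, ?_⟩
          · split_ifs at h1 <;> omega
          · by_contra hvX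
            rw [if_neg hvX] at h1
            omega
        · left
          have h1 := hμ A hAO v
          by_cases hvz : v = z
          · rw [if_pos hvz]
            omega
          rw [if_neg hvz]
          by_cases hvA : v ∈ A
          · have := h1.2.2 hvA
            omega
          · have : d v % 2 ≠ 1 := fun h =>
              hvO ⟨Finset.mem_filter.2 ⟨hv, hvz, h⟩, hvA⟩
            omega
    rw [Finset.sum_sub_distrib, Finset.sum_sub_distrib, ← Finset.mul_sum, Finset.sum_ite_eq',
      if_pos hz] at hkey
    have h3 : (∑ v ∈ V, (d v : ℤ)) = 2 * E.card := by exact_mod_cast hdV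
    have h4 : (E.card : ℤ) < ∑ v ∈ V, (μ A v : ℤ) := by exact_mod_cast hlt
    omega
  obtain ⟨t, h, hth, hdeg⟩ := exists_orientation_of_inner_le ha hb (μ := μ A) (by
    intro X hX
    rcases X.eq_empty_or_nonempty with rfl | hne
    · simp [inner]
    · exact (Nat.le_add_right _ _).trans (hAX X hX hne)) hsumV
  have hinner : ∀ X, inner E t h X = inner E a b X := by
    intro X
    unfold inner
    congr 1
    refine Finset.filter_congr fun e he => ?_
    rcases hth e he with h1 | h1 <;> simp only [h1.1, h1.2]
    tauto
  refine ⟨t, h, hth, ?_, ?_, ?_, ?_⟩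
  · intro X hX hne hzX
    have h1 := hAX X hX hne
    have h2 := endCount_eq_inner_add_inCut E t h X
    have h3 : ∑ v ∈ X, endCount E h {v} = ∑ v ∈ X, μ A v :=
      Finset.sum_congr rfl fun v hv => hdeg v (hX hv)
    rw [sum_endCount] at h3
    rw [hinner] at h2
    simp only [p, if_neg hzX] at h1
    omega
  · intro v hv
    have := hμ A hAO v
    rw [hdeg v hv]
    change d v / 2 ≤ _
    omega
  · intro v hv
    have := hμ A hAO v
    rw [hdeg v hv]
    change _ ≤ (d v + 1) / 2
    omega
  · rw [hdeg z hz]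
    have : z ∉ A := fun h => by simpa [O] using hAO h
    simp [μ, this, d]

/-! ### Edmonds' disjoint arborescences -/

open Classical in
/-- The arcs of `A` form a tree on `U` in which all arcs are directed away from `z`. -/
structure IsArborescence (U : Finset α) (A : Finset β) (t h : β → α) (z : α) : Prop where
  exists_rank : ∃ r : α → ℕ, ∀ e ∈ A, r (t e) < r (h e)
  tail_mem : ∀ e ∈ A, t e ∈ U
  head_mem : ∀ e ∈ A, h e ∈ U
  endCount_head : ∀ v ∈ U, endCount A h {v} = if v = z then 0 else 1

/-- The in-degree sum is modular and `inner` is supermodular; `inCut` is their difference. -/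
lemma inCut_submodular [DecidableEq α] (E : Finset β) (t h : β → α) (X Y : Finset α) :
    inCut E t h (X ∪ Y) + inCut E t h (X ∩ Y) ≤ inCut E t h X + inCut E t h Y := by
  classical
  have h1 := inner_supermodular E t h X Y
  have h2 : endCount E h (X ∪ Y) + endCount E h (X ∩ Y) = endCount E h X + endCount E h Y := by
    rw [← sum_endCount, ← sum_endCount, ← sum_endCount, ← sum_endCount]
    exact Finset.sum_union_inter
  simp only [endCount_eq_inner_add_inCut E t h] at h2
  omega

lemma endCount_insert [DecidableEq β] [DecidableEq α] {A : Finset β} {e : β} (he : e ∉ A)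
    (p : β → α) (X : Finset α) :
    endCount (insert e A) p X = endCount A p X + if p e ∈ X then 1 else 0 := by
  classical
  unfold endCount
  rw [Finset.filter_insert]
  split_ifs with hX
  · rw [← Finset.card_insert_of_notMem (a := e) (by simp [he])]
  · rfl

open Classical in
/-- The induction step in the proof of Edmonds' theorem: a partial arborescence can be extended. -/
lemma IsArborescence.exists_insert {V : Finset α} {E : Finset β} {t h : β → α} {z : α} {k : ℕ}
    (ht : ∀ e ∈ E, t e ∈ V) (hh : ∀ e ∈ E, h e ∈ V)
    (hcut : ∀ X ⊆ V, X.Nonempty → z ∉ X → k + 1 ≤ inCut E t h X)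
    {U : Finset α} {A : Finset β} (hA : IsArborescence U A t h z) (hzU : z ∈ U) (hUV : U ⊆ V)
    (hne : U ≠ V) (hcutA : ∀ X ⊆ V, X.Nonempty → z ∉ X → k ≤ inCut (E \ A) t h X) :
    ∃ e ∈ E, h e ∈ V ∧ h e ∉ U ∧ IsArborescence (insert (h e) U) (insert e A) t h z ∧
      ∀ X ⊆ V, X.Nonempty → z ∉ X → k ≤ inCut (E \ insert e A) t h X := by
  -- Lovász's argument: choose a minimal tight set `X` not inside `U`, with `V` as a fallback. At
  -- least `k + 1` arcs enter `X \ U`, none of them in `A`, but at most `k` arcs outside `A` enter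
  -- `X`; so some arc runs from `X ∩ U` to `X \ U`.
  let F : Finset α → Prop := fun X => ¬ X ⊆ U ∧ (X = V ∨ (z ∉ X ∧ inCut (E \ A) t h X = k))
  have hVF : V ∈ V.powerset.filter F :=
    Finset.mem_filter.2 ⟨by simp, fun hVU => hne (hUV.antisymm hVU), .inl rfl⟩
  obtain ⟨X, hX, hmin⟩ := Finset.exists_min_image _ Finset.card ⟨_, hVF⟩
  obtain ⟨hXV, hXU, hXF⟩ := Finset.mem_filter.1 hX
  rw [Finset.mem_powerset] at hXV
  obtain ⟨e, heE, hte, hteU, hheX, hheU⟩ : ∃ e ∈ E, t e ∈ X ∧ t e ∈ U ∧ h e ∈ X ∧ h e ∉ U := by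
    have hXk : inCut (E \ A) t h X ≤ k := by
      rcases hXF with rfl | hXF
      · unfold inCut
        rw [Finset.filter_false_of_mem fun e he => by
          simp [ht e (Finset.mem_sdiff.1 he).1]]
        simp
      · exact hXF.2.le
    have h1 := hcut (X \ U) (Finset.sdiff_subset.trans hXV) (Finset.sdiff_nonempty.2 hXU)
      (by simp [hzU])
    by_contra! hcon
    have h2 : inCut E t h (X \ U) ≤ inCut (E \ A) t h X := by
      refine Finset.card_le_card fun f hf => ?_
      simp only [Finset.mem_filter, Finset.mem_sdiff] at hf ⊢
      refine ⟨⟨hf.1, fun hfA => hf.2.2.2 (hA.head_mem f hfA)⟩, fun htX => ?_, hf.2.2.1⟩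
      exact hf.2.2.2 (hcon f hf.1 htX (by tauto) hf.2.2.1)
    omega
  have heA : e ∉ A := fun h => hheU (hA.head_mem e h)
  refine ⟨e, heE, hh e heE, hheU, ?_, ?_⟩
  · obtain ⟨r, hr⟩ := hA.exists_rank
    refine ⟨⟨Function.update r (h e) (r (t e) + 1), ?_⟩, ?_, ?_, ?_⟩
    · have hne : ∀ u ∈ U, u ≠ h e := fun u hu h => hheU (h ▸ hu)
      intro f hf
      rcases Finset.mem_insert.1 hf with rfl | hf
      · simp [hne _ hteU]
      · simp [hne _ (hA.tail_mem f hf), hne _ (hA.head_mem f hf), hr f hf]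
    · intro f hf
      rcases Finset.mem_insert.1 hf with rfl | hf
      · simp [hteU]
      · simp [hA.tail_mem f hf]
    · intro f hf
      rcases Finset.mem_insert.1 hf with rfl | hf
      · simp
      · simp [hA.head_mem f hf]
    · intro v hv
      rw [endCount_insert heA]
      by_cases hve : v = h e
      · subst hve
        have h0 : endCount A h {h e} = 0 := by
          unfold endCount
          rw [Finset.filter_false_of_mem, Finset.card_empty]
          intro f hf
          rw [Finset.mem_singleton]
          exact fun h => hheU (h ▸ hA.head_mem f hf)
        have hez : h e ≠ z := fun h => hheU (h ▸ hzU)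
        simp [h0, hez]
      · rw [hA.endCount_head v ((Finset.mem_insert.1 hv).resolve_left hve)]
        simp [Ne.symm hve]
  · intro Y hY hYne hzY
    have h1 := hcutA Y hY hYne hzY
    by_cases heY : t e ∉ Y ∧ h e ∈ Y
    · have h2 : inCut (E \ insert e A) t h Y + 1 = inCut (E \ A) t h Y := by
        unfold inCut
        rw [← Finset.card_insert_of_notMem (a := e) (by simp)]
        congr 1
        ext f
        simp only [Finset.mem_insert, Finset.mem_filter, Finset.mem_sdiff]
        by_cases hfe : f = e
        · subst hfe
          simp [heE, heA, heY]
        · simp [hfe]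
      -- If `Y` were tight and entered by `e`, submodularity would make `X ∩ Y` tight. It misses `t
      -- e`, contradicting the minimality of `X`.
      suffices h3 : inCut (E \ A) t h Y ≠ k by omega
      intro hYk
      have hXY : X ∩ Y ∈ V.powerset.filter F := by
        refine Finset.mem_filter.2 ⟨Finset.mem_powerset.2 (Finset.inter_subset_left.trans hXV),
          fun h => hheU (h (Finset.mem_inter.2 ⟨hheX, heY.2⟩)), .inr ⟨by simp [hzY], ?_⟩⟩
        rcases hXF with rfl | ⟨hzX, hXk⟩
        · rw [Finset.inter_eq_right.2 hY, hYk]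
        · have h3 := inCut_submodular (E \ A) t h X Y
          have h4 := hcutA (X ∩ Y) (Finset.inter_subset_left.trans hXV)
            ⟨h e, Finset.mem_inter.2 ⟨hheX, heY.2⟩⟩ (by simp [hzY])
          have h5 := hcutA (X ∪ Y) (Finset.union_subset hXV hY)
            ⟨h e, Finset.mem_union_left _ hheX⟩ (by simp [hzY, hzX])
          omega
      have h6 : (X ∩ Y).card < X.card := by
        refine Finset.card_lt_card ⟨Finset.inter_subset_left, fun h => heY.1 ?_⟩
        exact (Finset.mem_inter.1 (h hte)).2
      exact absurd (hmin _ hXY) (not_le.2 h6)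
    · have h2 : inCut (E \ insert e A) t h Y = inCut (E \ A) t h Y := by
        unfold inCut
        congr 1
        ext f
        simp only [Finset.mem_insert, Finset.mem_filter, Finset.mem_sdiff]
        by_cases hfe : f = e
        · subst hfe
          simp [heY]
        · simp [hfe]
      omega

-- A largest partial arborescence whose removal leaves all cuts at least `k` must span, since
-- otherwise it could be extended; the single vertex `z` is the starting case.
open Classical in
lemma exists_arborescence {V : Finset α} {E : Finset β} {t h : β → α} {z : α} {k : ℕ}
    (hz : z ∈ V) (ht : ∀ e ∈ E, t e ∈ V) (hh : ∀ e ∈ E, h e ∈ V)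
    (hcut : ∀ X ⊆ V, X.Nonempty → z ∉ X → k + 1 ≤ inCut E t h X) :
    ∃ A ⊆ E, IsArborescence V A t h z ∧
      ∀ X ⊆ V, X.Nonempty → z ∉ X → k ≤ inCut (E \ A) t h X := by
  let P : Finset α → Prop := fun U => z ∈ U ∧ ∃ A ⊆ E, IsArborescence U A t h z ∧
    ∀ X ⊆ V, X.Nonempty → z ∉ X → k ≤ inCut (E \ A) t h X
  have hP : {z} ∈ V.powerset.filter P := by
    refine Finset.mem_filter.2 ⟨by simpa using hz, by simp, ∅, by simp, ⟨⟨0, by simp⟩, by simp,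
      by simp, ?_⟩, fun X hX hne hzX => ?_⟩
    · intro v hv
      simp [endCount, Finset.mem_singleton.1 hv]
    · rw [Finset.sdiff_empty]
      exact (Nat.le_succ k).trans (hcut X hX hne hzX)
  obtain ⟨U, hU, hmax⟩ := Finset.exists_max_image _ Finset.card ⟨_, hP⟩
  obtain ⟨hUV, hzU, A, hAE, hA, hcutA⟩ := Finset.mem_filter.1 hU
  rw [Finset.mem_powerset] at hUV
  by_cases hne : U = V
  · exact ⟨A, hAE, hne ▸ hA, hcutA⟩
  · obtain ⟨e, heE, hheV, hheU, hA', hcutA'⟩ := hA.exists_insert ht hh hcut hzU hUV hne hcutA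
    have := hmax (insert (h e) U) (Finset.mem_filter.2
      ⟨Finset.mem_powerset.2 (Finset.insert_subset hheV hUV), Finset.mem_insert_of_mem hzU,
        insert e A, Finset.insert_subset heE hAE, hA', hcutA'⟩)
    rw [Finset.card_insert_of_notMem hheU] at this
    omega

/-- Edmonds' theorem: if every nonempty set of vertices without `z` is entered by at least `k` arcs,
then there are `k` pairwise disjoint spanning arborescences with root `z`. -/
theorem exists_disjoint_arborescences {V : Finset α} {t h : β → α} {z : α} (hz : z ∈ V) (k : ℕ)
    {E : Finset β} (ht : ∀ e ∈ E, t e ∈ V) (hh : ∀ e ∈ E, h e ∈ V)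
    (hcut : ∀ X ⊆ V, X.Nonempty → z ∉ X → k ≤ inCut E t h X) :
    ∃ T : Fin k → Finset β, (∀ i, T i ⊆ E ∧ IsArborescence V (T i) t h z) ∧
      ∀ i j, i ≠ j → Disjoint (T i) (T j) := by
  classical
  induction k generalizing E with
  | zero => exact ⟨Fin.elim0, fun i => i.elim0, fun i => i.elim0⟩
  | succ k ih =>
    obtain ⟨A, hAE, hA, hcutA⟩ := exists_arborescence hz ht hh hcut
    obtain ⟨T, hT, hdisj⟩ := ih (E := E \ A) (fun e he => ht e (Finset.mem_sdiff.1 he).1)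
      (fun e he => hh e (Finset.mem_sdiff.1 he).1) hcutA
    have hAT : ∀ i, Disjoint A (T i) := fun i =>
      Finset.disjoint_sdiff.mono_right (hT i).1
    refine ⟨Fin.cons A T, fun i => ?_, fun i j => ?_⟩
    · refine Fin.cases ⟨hAE, hA⟩ (fun i => ?_) i
      exact ⟨(hT i).1.trans Finset.sdiff_subset, (hT i).2⟩
    · refine Fin.cases ?_ (fun i => ?_) i <;> refine Fin.cases ?_ (fun j => ?_) j
      · simp
      · simpa using fun _ => hAT j
      · simpa using (hAT i).symm
      · simpa using hdisj i j

lemma IsArborescence.exists_arc {V : Finset α} {A : Finset β} {t h : β → α} {z v : α}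
    (hA : IsArborescence V A t h z) (hv : v ∈ V) (hvz : v ≠ z) : ∃ e ∈ A, h e = v := by
  have h1 := hA.endCount_head v hv
  rw [if_neg hvz] at h1
  obtain ⟨e, he⟩ := Finset.card_pos.1 (h1.symm ▸ Nat.one_pos : 0 < endCount A h {v})
  exact ⟨e, by simpa using he⟩

lemma IsArborescence.head_injOn {V : Finset α} {A : Finset β} {t h : β → α} {z : α}
    (hA : IsArborescence V A t h z) {e f : β} (he : e ∈ A) (hf : f ∈ A) (hef : h e = h f) :
    e = f := by
  have h1 := hA.endCount_head (h e) (hA.head_mem e he)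
  refine Finset.card_le_one.1 (?_ : endCount A h {h e} ≤ 1) e (by simp [he]) f (by simp [hf, hef])
  rw [h1]
  split_ifs <;> simp

lemma IsArborescence.spans {V : Finset α} {A : Finset β} {t h : β → α} {z : α}
    (hA : IsArborescence V A t h z) : Spans V A t h z := by
  obtain ⟨r, hr⟩ := hA.exists_rank
  intro v hv
  induction hn : r v using Nat.strong_induction_on generalizing v with
  | _ n ih =>
  by_cases hvz : v = z
  · rw [hvz]
  · obtain ⟨e, he, rfl⟩ := hA.exists_arc hv hvz
    exact (ih _ (hn ▸ hr e he) _ (hA.tail_mem e he) rfl).tail ⟨e, he, rfl, rfl⟩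

/-- On at least two vertices, some arc of an arborescence leaves the root. -/
lemma IsArborescence.one_le_endCount_root {V : Finset α} {A : Finset β} {t h : β → α} {z v : α}
    (hA : IsArborescence V A t h z) (hv : v ∈ V) (hvz : v ≠ z) : 1 ≤ endCount A t {z} := by
  rcases (hA.spans v hv).cases_head with h1 | ⟨b, ⟨e, he, hte, -⟩, -⟩
  · exact absurd h1.symm hvz
  · exact Finset.card_pos.2 ⟨e, by simp [he, hte]⟩

/-! ### Arc sets between reserved arborescences -/

lemma endCount_union [DecidableEq β] {A B : Finset β} (hAB : Disjoint A B) (p : β → α)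
    (X : Finset α) : endCount (A ∪ B) p X = endCount A p X + endCount B p X := by
  classical
  unfold endCount
  rw [Finset.filter_union, Finset.card_union_of_disjoint
    (Finset.disjoint_filter_filter hAB)]

lemma endCount_biUnion [DecidableEq β] {ι : Type*} (s : Finset ι) {T : ι → Finset β}
    (hT : ∀ i j, i ≠ j → Disjoint (T i) (T j)) (p : β → α) (X : Finset α) :
    endCount (s.biUnion T) p X = ∑ i ∈ s, endCount (T i) p X := by
  classical
  unfold endCount
  rw [Finset.filter_biUnion, Finset.card_biUnion]
  intro i _ j _ hij
  exact Finset.disjoint_filter_filter (hT i j hij)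

lemma endCount_singleton_eq_endSum (E : Finset β) (p : β → α) (v : α) :
    (endCount E p {v} : ℤ) = endSum E p 1 v := by
  rw [endSum_one]
  unfold endCount
  congr 2
  ext e
  simp

lemma endCount_filter_eq_endSum {R : Finset β} {x : β → ℤ} (hx : ∀ e ∈ R, x e = 0 ∨ x e = 1)
    (p : β → α) (v : α) : (endCount (R.filter (x · = 1)) p {v} : ℤ) = endSum R p x v := by
  classical
  rw [endCount_singleton_eq_endSum]
  unfold endSum
  rw [Finset.sum_filter]
  refine Finset.sum_congr rfl fun e he => ?_
  rcases hx e he with h | h <;> simp [h]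

lemma endCount_sdiff_add [DecidableEq β] {A E : Finset β} (hAE : A ⊆ E) (p : β → α)
    (X : Finset α) : endCount (E \ A) p X + endCount A p X = endCount E p X := by
  rw [← endCount_union Finset.sdiff_disjoint, Finset.sdiff_union_of_subset hAE]

lemma exists_int_add_eq (a b : ZMod 2) : ∃ x : ℤ, (x = 0 ∨ x = 1) ∧ a + x = b := by
  refine ⟨((b - a).val : ℤ), ?_, by simp⟩
  have := ZMod.val_lt (b - a)
  omega

lemma even_iff_intCast_eq_zero (a : ℤ) : Even a ↔ (a : ZMod 2) = 0 := by
  rw [ZMod.intCast_zmod_eq_zero_iff_dvd, even_iff_two_dvd]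
  norm_num

lemma even_sub_iff_intCast_eq (a b : ℤ) : Even (a - b) ↔ (a : ZMod 2) = b := by
  rw [even_iff_intCast_eq_zero, Int.cast_sub, sub_eq_zero]

open Classical in
/-- In a digraph with `m + (m₀ + 1)` disjoint spanning arborescences with root `z`, whose in-degrees
and out-degrees are almost equal, one can choose arcs that contain `m` of the arborescences, avoid
`m₀` of them, and have prescribed parities and bounded degrees. -/
theorem exists_parity_subset {V : Finset α} {E : Finset β} {t h : β → α} {z w : α}
    (hz : z ∈ V) (hw : w ∈ V) (hwz : w ≠ z) (ht : ∀ e ∈ E, t e ∈ V) (hh : ∀ e ∈ E, h e ∈ V)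
    {m m₀ : ℕ} {T : Fin (m + (m₀ + 1)) → Finset β}
    (hTE : ∀ i, T i ⊆ E) (hT : ∀ i, IsArborescence V (T i) t h z)
    (hdisj : ∀ i j, i ≠ j → Disjoint (T i) (T j)) {d : α → ℕ}
    (hd : ∀ v ∈ V, endCount E t {v} + endCount E h {v} = d v)
    (hlow : ∀ v ∈ V, d v / 2 ≤ endCount E h {v})
    (hhz : endCount E h {z} = (d z + 1) / 2) {f : α → ZMod 2} (hf : ∑ v ∈ V, f v = 0)
    {r : ℤ} (hr1 : (d z : ℤ) / 2 - 1 - m₀ ≤ r) (hr2 : r ≤ ((d z : ℤ) + 1) / 2 + 1 + m)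
    (hrf : (r : ZMod 2) = f z) :
    ∃ F ⊆ E, (∀ i, T (Fin.castAdd (m₀ + 1) i) ⊆ F) ∧
      (∀ j : Fin m₀, Disjoint (T (Fin.natAdd m j.castSucc)) F) ∧
      (∀ v ∈ V, ((endCount F t {v} + endCount F h {v} : ℤ) : ZMod 2) = f v) ∧
      (∀ v ∈ V, (d v : ℤ) / 2 - 1 - m₀ ≤ endCount F t {v} + endCount F h {v}) ∧
      (∀ v ∈ V, (endCount F t {v} + endCount F h {v} : ℤ) ≤ ((d v : ℤ) + 1) / 2 + 1 + m) ∧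
      (endCount F t {z} + endCount F h {z} : ℤ) = r := by
  let A : Finset β := Finset.univ.biUnion fun i : Fin m => T (Fin.castAdd (m₀ + 1) i)
  let B : Finset β := Finset.univ.biUnion fun j : Fin m₀ => T (Fin.natAdd m j.castSucc)
  let C : Finset β := T (Fin.natAdd m (Fin.last m₀))
  have hAB : Disjoint A B := by
    simp only [A, B, Finset.disjoint_biUnion_left, Finset.disjoint_biUnion_right]
    intro i _ j _
    exact hdisj _ _ (by simp [Fin.ext_iff]; omega)
  have hCAB : Disjoint C (A ∪ B) := by
    simp only [A, B, C, Finset.disjoint_union_right, Finset.disjoint_biUnion_right]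
    refine ⟨fun i _ => hdisj _ _ ?_, fun j _ => hdisj _ _ ?_⟩
    · simp [Fin.ext_iff]; omega
    · simp [Fin.ext_iff]; omega
  have hABE : A ∪ B ⊆ E := Finset.union_subset
    (Finset.biUnion_subset.2 fun i _ => hTE _) (Finset.biUnion_subset.2 fun i _ => hTE _)
  have hA (p : β → α) (v : α) :
      endCount A p {v} = ∑ i : Fin m, endCount (T (Fin.castAdd (m₀ + 1) i)) p {v} :=
    endCount_biUnion _ (fun i j hij => hdisj _ _ (by simpa using hij)) p {v}
  have hB (p : β → α) (v : α) :
      endCount B p {v} = ∑ j : Fin m₀, endCount (T (Fin.natAdd m j.castSucc)) p {v} :=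
    endCount_biUnion _ (fun i j hij => hdisj _ _ (by simpa using hij)) p {v}
  have hAh : ∀ v ∈ V, endCount A h {v} = if v = z then 0 else m := by
    intro v hv
    rw [hA, Finset.sum_congr rfl fun i _ => (hT _).endCount_head v hv]
    split_ifs <;> simp
  have hBh : ∀ v ∈ V, endCount B h {v} = if v = z then 0 else m₀ := by
    intro v hv
    rw [hB, Finset.sum_congr rfl fun i _ => (hT _).endCount_head v hv]
    split_ifs <;> simp
  have hAt : m ≤ endCount A t {z} := by
    rw [hA]
    calc m = ∑ i : Fin m, 1 := by simp
      _ ≤ _ := Finset.sum_le_sum fun i _ => (hT _).one_le_endCount_root hw hwz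
  have hBt : m₀ ≤ endCount B t {z} := by
    rw [hB]
    calc m₀ = ∑ i : Fin m₀, 1 := by simp
      _ ≤ _ := Finset.sum_le_sum fun i _ => (hT _).one_le_endCount_root hw hwz
  let R : Finset β := E \ (A ∪ B)
  have hR (p : β → α) (v : α) :
      endCount R p {v} + (endCount A p {v} + endCount B p {v}) = endCount E p {v} := by
    rw [← endCount_union hAB, endCount_sdiff_add hABE]
  -- Away from `z` each bound is picked from two consecutive integers to match the parity of `f v`;
  -- at `z` both bounds are `r`.
  have hbounds : ∀ v, ∃ l u : ℤ, l ≤ u ∧ (l : ZMod 2) = f v ∧ (u : ZMod 2) = f v ∧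
      (d v : ℤ) / 2 - 1 - m₀ ≤ l ∧ u ≤ ((d v : ℤ) + 1) / 2 + 1 + m ∧
      (v ≠ z → l ≤ (d v : ℤ) / 2 - m₀ ∧ ((d v : ℤ) + 1) / 2 + m ≤ u) ∧
      (v = z → l = r ∧ u = r) := by
    intro v
    by_cases hvz : v = z
    · subst hvz
      exact ⟨r, r, le_rfl, hrf, hrf, hr1, hr2, fun h => absurd rfl h, fun _ => ⟨rfl, rfl⟩⟩
    · obtain ⟨x, hx, hxl⟩ := exists_int_add_eq (((d v : ℤ) / 2 - 1 - m₀ : ℤ) : ZMod 2) (f v)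
      obtain ⟨y, hy, hyu⟩ := exists_int_add_eq (((d v + 1 : ℤ) / 2 + m : ℤ) : ZMod 2) (f v)
      refine ⟨(d v : ℤ) / 2 - 1 - m₀ + x, (d v + 1 : ℤ) / 2 + m + y, by omega, ?_, ?_, by omega,
        by omega, fun _ => by omega, fun h => absurd h hvz⟩
      · rw [← hxl, Int.cast_add]
      · rw [← hyu, Int.cast_add]
  choose l u hlu hlf huf hl hu hne heq using hbounds
  -- The degrees already contributed by `A` are subtracted. At `z` the bounds hold because `A` and
  -- `B` send out at least `m` and `m₀` arcs there and receive none. The parity offset 0 makes the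
  -- two end values of each arc equal, so a solution is a subset of `R`.
  have hdata : ParityBounds V R t h z 0
      (fun v => l v - endCount A t {v} - endCount A h {v})
      (fun v => u v - endCount A t {v} - endCount A h {v}) :=
    { root_mem := hz
      tail_mem := fun e he => ht e (Finset.mem_sdiff.1 he).1
      head_mem := fun e he => hh e (Finset.mem_sdiff.1 he).1
      spans := fun v hv => Relation.ReflTransGen.mono (fun a b => Step.mono
        (Finset.subset_sdiff.2 ⟨hTE _, hCAB⟩)) _ _ ((hT _).spans v hv)
      le := fun v _ => by have := hlu v; linarith
      even_sub := fun v _ => by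
        have : Even (u v - l v) := by rw [even_sub_iff_intCast_eq, hlf, huf]
        convert this using 1
        ring
      lb_le := fun v hv => by
        rw [← endCount_singleton_eq_endSum]
        have h1 := hR h v
        have h2 := hlow v hv
        rw [hAh v hv] at h1 ⊢
        rw [hBh v hv] at h1
        by_cases hvz : v = z
        · subst hvz
          have h3 := heq v rfl
          simp only [if_true] at *
          omega
        · have h3 := hne v hvz
          simp only [if_neg hvz] at *
          omega
      le_ub := fun v hv => by
        rw [← endCount_singleton_eq_endSum]
        have h1 := hR t v
        have h2 := hlow v hv
        have h4 := hd v hv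
        rw [hAh v hv]
        by_cases hvz : v = z
        · subst hvz
          have h3 := heq v rfl
          simp only [if_true] at *
          omega
        · have h3 := hne v hvz
          simp only [if_neg hvz] at *
          omega
      even_sum := by
        have h1 : ∑ v ∈ V, (endCount A t {v} : ℤ) = A.card := by
          rw [← Nat.cast_sum, sum_endCount]
          unfold endCount
          rw [Finset.filter_true_of_mem]
          exact fun e he => ht e (hABE (Finset.mem_union_left _ he))
        have h2 : ∑ v ∈ V, (endCount A h {v} : ℤ) = A.card := by
          rw [← Nat.cast_sum, sum_endCount]
          unfold endCount
          rw [Finset.filter_true_of_mem]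
          exact fun e he => hh e (hABE (Finset.mem_union_left _ he))
        have h3 : Even (∑ v ∈ V, l v) := by
          rw [even_iff_intCast_eq_zero, Int.cast_sum, ← hf]
          exact Finset.sum_congr rfl fun v _ => hlf v
        rw [Finset.sum_sub_distrib, Finset.sum_sub_distrib, h1, h2]
        simp only [Pi.zero_apply, Finset.sum_const_zero]
        rw [Int.even_iff] at *
        omega }
  obtain ⟨x, y, hxy, hv⟩ := hdata.solvable
  have hyx : ∀ e ∈ R, y e = x e := by
    intro e he
    obtain ⟨h1, h2, h3⟩ := hxy e he
    rw [Pi.zero_apply, Int.even_iff] at h3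
    omega
  let F₀ : Finset β := R.filter (x · = 1)
  have hAF : Disjoint A F₀ :=
    ((Finset.sdiff_disjoint.mono_left (Finset.filter_subset _ _)).mono_right
      Finset.subset_union_left).symm
  have hBF : Disjoint B F₀ :=
    ((Finset.sdiff_disjoint.mono_left (Finset.filter_subset _ _)).mono_right
      Finset.subset_union_right).symm
  have hdeg : ∀ v ∈ V, l v ≤ endCount (A ∪ F₀) t {v} + endCount (A ∪ F₀) h {v} ∧
      (endCount (A ∪ F₀) t {v} + endCount (A ∪ F₀) h {v} : ℤ) ≤ u v ∧
      ((endCount (A ∪ F₀) t {v} + endCount (A ∪ F₀) h {v} : ℤ) : ZMod 2) = f v := by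
    intro v hvV
    obtain ⟨h1, h2, h3⟩ := hv v hvV
    rw [endSum_congr (fun _ _ => rfl) hyx, ← endCount_filter_eq_endSum fun e he => (hxy e he).1,
      ← endCount_filter_eq_endSum fun e he => (hxy e he).1] at h1 h2 h3
    rw [endCount_union hAF, endCount_union hAF]
    push_cast
    refine ⟨by linarith, by linarith, ?_⟩
    rw [← hlf v]
    have h4 := (even_sub_iff_intCast_eq _ _).1 h3
    push_cast at h4
    linear_combination h4
  refine ⟨A ∪ F₀, ?_, ?_, ?_, fun v hv => (hdeg v hv).2.2, fun v hv => (hl v).trans (hdeg v hv).1,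
    fun v hv => (hdeg v hv).2.1.trans (hu v), ?_⟩
  · exact Finset.union_subset (Finset.subset_union_left.trans hABE)
      ((Finset.filter_subset _ _).trans Finset.sdiff_subset)
  · exact fun i => Finset.subset_union_left.trans' (Finset.subset_biUnion_of_mem
      (fun i : Fin m => T (Fin.castAdd (m₀ + 1) i)) (Finset.mem_univ i))
  · intro j
    exact (Finset.disjoint_union_right.2 ⟨hAB.symm, hBF⟩).mono_left (Finset.subset_biUnion_of_mem
      (fun j : Fin m₀ => T (Fin.natAdd m j.castSucc)) (Finset.mem_univ j))
  · obtain ⟨h1, h2, -⟩ := hdeg z hz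
    have := heq z rfl
    omega

end Arcs

/-! ### From arcs back to multigraphs -/

namespace Graph

open Arcs

variable {α β : Type*} {G : Graph α β}

open Classical in
lemma degree_restrict_eq {t h : β → α} (hth : ∀ e ∈ E(G), G.IsLink e (t e) (h e)) {F : Finset β}
    (hF : (F : Set β) ⊆ E(G)) (v : α) :
    (G.restrict F).degree v = endCount F t {v} + endCount F h {v} := by
  have h1 : {e | (G.restrict F).IsNonloopAt e v} =
      (F.filter fun e => (t e = v ∧ h e ≠ v) ∨ (h e = v ∧ t e ≠ v) : Finset β) := by
    ext e
    simp only [IsNonloopAt, restrict_isLink, Finset.coe_filter, Set.mem_ofPred_eq, Finset.mem_coe]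
    constructor
    · rintro ⟨y, hy, he, hl⟩
      refine ⟨he, ?_⟩
      rcases (hth e (hF he)).eq_and_eq_or_eq_and_eq hl with ⟨h1, h2⟩ | ⟨h1, h2⟩
      · exact .inl ⟨h1, h2 ▸ hy⟩
      · exact .inr ⟨h2, h1 ▸ hy⟩
    · rintro ⟨he, ⟨h1, h2⟩ | ⟨h1, h2⟩⟩
      · exact ⟨h e, h2, he, h1 ▸ hth e (hF he)⟩
      · exact ⟨t e, h2, he, h1 ▸ (hth e (hF he)).symm⟩
  have h2 : {e | (G.restrict F).IsLoopAt e v} =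
      (F.filter fun e => t e = v ∧ h e = v : Finset β) := by
    ext e
    simp only [IsLoopAt, restrict_isLink, Finset.coe_filter, Set.mem_ofPred_eq, Finset.mem_coe]
    refine and_congr_right fun he => ?_
    constructor
    · intro hl
      rcases (hth e (hF he)).eq_and_eq_or_eq_and_eq hl with h1 | h1
      · exact h1
      · exact h1
    · rintro ⟨h1, h2⟩
      have := hth e (hF he)
      rwa [h1, h2] at this
  unfold degree endCount
  rw [h1, h2, Set.ncard_coe_finset, Set.ncard_coe_finset]
  simp only [Finset.card_filter, Finset.mem_singleton]
  rw [Finset.mul_sum, ← Finset.sum_add_distrib, ← Finset.sum_add_distrib]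
  refine Finset.sum_congr rfl fun e _ => ?_
  by_cases h3 : t e = v <;> by_cases h4 : h e = v <;> simp [h3, h4]

/-- Deleting all edges between `X` and its complement separates `z` from `X`. -/
lemma EdgeConnected.le_inCut {n : ℕ} (hG : G.EdgeConnected n) {V : Finset α} {E : Finset β}
    (hV : (V : Set α) = V(G)) (hE : (E : Set β) = E(G)) {t h : β → α}
    (hth : ∀ e ∈ E(G), G.IsLink e (t e) (h e)) {X : Finset α} (hXV : X ⊆ V) (hX : X.Nonempty)
    {z : α} (hz : z ∈ V) (hzX : z ∉ X) : n ≤ inCut E t h X + inCut E h t X := by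
  classical
  by_contra! hlt
  let S : Finset β := (E.filter fun e => t e ∉ X ∧ h e ∈ X) ∪
    (E.filter fun e => h e ∉ X ∧ t e ∈ X)
  have hS : S.card < n := by
    refine (Finset.card_union_le _ _).trans_lt ?_
    simp only [inCut] at hlt
    convert hlt
  have hSE : (S : Set β) ⊆ E(G) := by
    rw [← hE]
    simp only [S, Finset.coe_subset]
    exact Finset.union_subset (Finset.filter_subset _ _) (Finset.filter_subset _ _)
  obtain ⟨x, hx⟩ := hX
  have hreach := (hG S hSE (by rw [Set.encard_coe_eq_coe_finsetCard]; exact_mod_cast hS)).2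
    z (by simpa [← hV] using hz) x (by simpa [← hV] using hXV hx)
  have key : ∀ y, Relation.ReflTransGen (G.deleteEdges S).Adj z y → y ∉ X := by
    intro y hy
    induction hy with
    | refl => exact hzX
    | @tail b c _ hbc ih =>
      obtain ⟨e, he⟩ := hbc
      simp only [deleteEdges_isLink, Finset.mem_coe] at he
      have heE : e ∈ E := by
        rw [← Finset.mem_coe, hE]
        exact he.1.edge_mem
      intro hc
      refine he.2 ?_
      simp only [S, Finset.mem_union, Finset.mem_filter]
      rcases (hth e he.1.edge_mem).eq_and_eq_or_eq_and_eq he.1 with ⟨h1, h2⟩ | ⟨h1, h2⟩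
      · exact .inl ⟨heE, h1 ▸ ih, h2 ▸ hc⟩
      · exact .inr ⟨heE, h2 ▸ ih, h1 ▸ hc⟩
  exact key x hreach hx

lemma isTree_restrict_of_isArborescence {V : Finset α} (hV : (V : Set α) = V(G)) {t h : β → α}
    (hth : ∀ e ∈ E(G), G.IsLink e (t e) (h e)) {A : Finset β} (hAE : (A : Set β) ⊆ E(G)) {z : α}
    (hz : z ∈ V) (hA : IsArborescence V A t h z) : (G.restrict A).IsTree := by
  refine ⟨⟨⟨z, by simpa [← hV] using hz⟩, ?_⟩, ?_⟩
  · have hroot : ∀ v ∈ V, Relation.ReflTransGen (G.restrict A).Adj z v := by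
      intro v hv
      refine Relation.ReflTransGen.mono ?_ _ _ (hA.spans v hv)
      rintro a b ⟨e, he, rfl, rfl⟩
      exact ⟨e, he, hth e (hAE he)⟩
    intro x hx y hy
    simp only [vertexSet_restrict, ← hV, Finset.mem_coe] at hx hy
    refine Relation.ReflTransGen.trans ?_ (hroot y hy)
    have := Relation.ReflTransGen.swap _ _ (hroot x hx)
    exact Relation.ReflTransGen.mono (fun a b hab => Adj.symm hab) _ _ this
  · rintro ⟨n, v, e, -, he, hl⟩
    obtain ⟨r, hr⟩ := hA.exists_rank
    -- A cycle vertex of maximal rank is the head of both cycle edges at it. In-degrees are at most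
    -- 1, so these edges coincide and the cycle is a loop, along which the rank cannot increase.
    obtain ⟨i, -, hi⟩ := Finset.exists_max_image Finset.univ (fun i => r (v i)) ⟨0, by simp⟩
    have hhead : ∀ f y, (G.restrict A).IsLink f (v i) y → r y ≤ r (v i) →
        f ∈ A ∧ h f = v i ∧ t f = y := by
      intro f y hf hy
      simp only [restrict_isLink, Finset.mem_coe] at hf
      refine ⟨hf.1, ?_⟩
      have hlt := hr f hf.1
      rcases (hth f (hAE hf.1)).eq_and_eq_or_eq_and_eq hf.2 with ⟨h1, h2⟩ | ⟨h1, h2⟩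
      · rw [h1, h2] at hlt
        omega
      · exact ⟨h2, h1⟩
    have h1 := hhead (e i) (v (i + 1)) (hl i) (hi _ (by simp))
    have h2 := hhead (e (i - 1)) (v (i - 1)) (by simpa using (hl (i - 1)).symm) (hi _ (by simp))
    have h3 : i = i - 1 := he (hA.head_injOn h1.1 h2.1 (h1.2.1.trans h2.2.1.symm))
    have h4 := hr _ h2.1
    rw [h2.2.1, h2.2.2, ← h3] at h4
    exact lt_irrefl _ h4

lemma treeConnected_of_isArborescence {V : Finset α} (hV : (V : Set α) = V(G)) {t h : β → α}
    (hth : ∀ e ∈ E(G), G.IsLink e (t e) (h e)) {z : α} (hz : z ∈ V) {m : ℕ}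
    {T : Fin m → Finset β} (hT : ∀ i, IsArborescence V (T i) t h z)
    (hdisj : ∀ i j, i ≠ j → Disjoint (T i) (T j)) {H : Graph α β} (hH : H ≤s G)
    (hTH : ∀ i, (T i : Set β) ⊆ E(H)) : H.TreeConnected m := by
  refine ⟨fun i => G.restrict (T i), fun i => ⟨?_, ?_⟩, fun i j hij => ?_⟩
  · refine IsSpanningSubgraph.anti_right ?_ hH.le ⟨restrict_le, rfl⟩
    refine (Compatible.of_le_le restrict_le hH.le).le_iff.2 ⟨?_, ?_⟩
    · rw [hH.vertexSet_eq]
      simp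
    · exact fun e he => hTH i he.2
  · exact isTree_restrict_of_isArborescence hV hth
      ((hTH i).trans (IsSubgraph.edgeSet_mono hH.le)) hz (hT i)
  · exact Disjoint.mono Set.inter_subset_right Set.inter_subset_right
      (Finset.disjoint_coe.2 (hdisj i j hij))

lemma floor_natCast_div_two (n : ℕ) : ⌊(n : ℚ) / 2⌋ = (n : ℤ) / 2 := by
  have := Rat.floor_intCast_div_natCast (n : ℤ) 2
  simpa using this

lemma ceil_natCast_div_two (n : ℕ) : ⌈(n : ℚ) / 2⌉ = ((n : ℤ) + 1) / 2 := by
  rw [Int.ceil_eq_iff]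
  obtain ⟨c, hc⟩ := Nat.even_or_odd' n
  have h : ((n : ℤ) + 1) / 2 = n - c := by omega
  rw [h]
  rcases hc with hc | hc <;> rw [hc] <;> push_cast <;> constructor <;> linarith

/-- Arborescences in `F` and in its complement, and bounds on the degrees of `F`, give a bounded
tree factor. -/
lemma isBoundedTreeFactor_restrict {V : Finset α} (hV : (V : Set α) = V(G)) {E : Finset β}
    (hE : (E : Set β) = E(G)) {t h : β → α}
    (hth : ∀ e ∈ E(G), G.IsLink e (t e) (h e)) {z : α} (hz : z ∈ V) {m m₀ : ℕ}
    {f : α → ZMod 2} {F : Finset β} (hFE : F ⊆ E)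
    {T : Fin m → Finset β} (hT : ∀ i, IsArborescence V (T i) t h z)
    (hdisj : ∀ i j, i ≠ j → Disjoint (T i) (T j)) (hTF : ∀ i, T i ⊆ F)
    {T' : Fin m₀ → Finset β} (hT' : ∀ i, IsArborescence V (T' i) t h z)
    (hdisj' : ∀ i j, i ≠ j → Disjoint (T' i) (T' j)) (hTE' : ∀ i, T' i ⊆ E)
    (hTF' : ∀ i, Disjoint (T' i) F)
    (hf : ∀ v ∈ V, ((endCount F t {v} + endCount F h {v} : ℤ) : ZMod 2) = f v)
    (hlb : ∀ v ∈ V, (endCount E t {v} + endCount E h {v} : ℤ) / 2 - 1 - m₀ ≤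
      endCount F t {v} + endCount F h {v})
    (hub : ∀ v ∈ V, (endCount F t {v} + endCount F h {v} : ℤ) ≤
      (endCount E t {v} + endCount E h {v} + 1 : ℤ) / 2 + 1 + m) :
    G.IsBoundedTreeFactor (G.restrict F) f m m₀ := by
  have hFG : (F : Set β) ⊆ E(G) := by rw [← hE]; exact_mod_cast hFE
  have hspan : G.restrict F ≤s G := ⟨restrict_le, rfl⟩
  have hmem : ∀ v, v ∈ V(G) ↔ v ∈ V := fun v => by rw [← hV, Finset.mem_coe]
  have hdegG : ∀ v, G.degree v = endCount E t {v} + endCount E h {v} := by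
    intro v
    rw [← degree_restrict_eq hth hE.subset, hE, restrict_self]
  have hdegF := degree_restrict_eq hth hFG
  refine ⟨⟨hspan, fun v hv => ?_⟩, ?_, ?_, fun v hv => ?_⟩
  · rw [← hf v ((hmem v).1 hv), hdegF]
    push_cast
    rfl
  · refine treeConnected_of_isArborescence hV hth hz hT hdisj hspan fun i e he => ?_
    exact ⟨hFG (hTF i he), hTF i he⟩
  · refine treeConnected_of_isArborescence hV hth hz hT' hdisj' ⟨deleteEdges_le, rfl⟩
      fun i e he => ?_
    refine ⟨hE ▸ hTE' i he, fun heF => ?_⟩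
    exact Finset.disjoint_left.1 (hTF' i) he heF.2
  · have h1 := hlb v ((hmem v).1 hv)
    have h2 := hub v ((hmem v).1 hv)
    rw [floor_natCast_div_two, ceil_natCast_div_two, hdegG, hdegF]
    push_cast
    exact ⟨h1, h2⟩

/-- A `(2 * m + 2 * m₀ + 2)`-edge-connected graph has a bounded tree factor with prescribed parities
and a prescribed admissible degree at `z`. -/
theorem exists_isBoundedTreeFactor_degree_eq (hV : V(G).Finite) (hE : E(G).Finite) {m m₀ : ℕ}
    {f : α → ZMod 2} (hf : ∑ v ∈ hV.toFinset, f v = 0)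
    (hG : G.EdgeConnected (2 * m + 2 * m₀ + 2)) {z : α} (hz : z ∈ V(G)) {r : ℤ}
    (hr1 : (G.degree z : ℤ) / 2 - 1 - m₀ ≤ r) (hr2 : r ≤ ((G.degree z : ℤ) + 1) / 2 + 1 + m)
    (hrd : V(G) = {z} → 0 ≤ r ∧ r ≤ G.degree z) (hrf : (r : ZMod 2) = f z) :
    ∃ H : Graph α β, G.IsBoundedTreeFactor H f m m₀ ∧ (H.degree z : ℤ) = r := by
  classical
  have hends : ∀ e, ∃ x y, e ∈ E(G) → G.IsLink e x y := by
    intro e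
    by_cases he : e ∈ E(G)
    · obtain ⟨x, y, hxy⟩ := exists_isLink_of_mem_edgeSet he
      exact ⟨x, y, fun _ => hxy⟩
    · exact ⟨z, z, fun h => absurd h he⟩
  choose a b hab using hends
  obtain ⟨V, hVG⟩ : ∃ V : Finset α, V = hV.toFinset := ⟨_, rfl⟩
  obtain ⟨E, hEG⟩ : ∃ E : Finset β, E = hE.toFinset := ⟨_, rfl⟩
  rw [← hVG] at hf
  have hVG : (V : Set α) = V(G) := by simp [hVG]
  have hEG : (E : Set β) = E(G) := by simp [hEG]
  have hmemE : ∀ e, e ∈ E ↔ e ∈ E(G) := fun e => by rw [← hEG, Finset.mem_coe]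
  have hmemV : ∀ v, v ∈ V ↔ v ∈ V(G) := fun v => by rw [← hVG, Finset.mem_coe]
  have hzV := (hmemV z).2 hz
  have ha : ∀ e ∈ E, a e ∈ V := fun e he => (hmemV _).2 (hab e ((hmemE e).1 he)).left_mem
  have hb : ∀ e ∈ E, b e ∈ V := fun e he => (hmemV _).2 (hab e ((hmemE e).1 he)).right_mem
  by_cases hone : ∃ w ∈ V, w ≠ z
  · obtain ⟨w, hw, hwz⟩ := hone
    obtain ⟨t, h, hth, hcut, hlow, -, hhz⟩ := exists_balanced_orientation
      (k := m + (m₀ + 1)) ha hb hzV fun X hXV hX hzX => by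
        have := hG.le_inCut hVG hEG hab hXV hX hzV hzX
        omega
    have hlink : ∀ e ∈ E(G), G.IsLink e (t e) (h e) := by
      intro e he
      rcases hth e ((hmemE e).2 he) with ⟨h1, h2⟩ | ⟨h1, h2⟩ <;> rw [h1, h2]
      · exact hab e he
      · exact (hab e he).symm
    have ht : ∀ e ∈ E, t e ∈ V := fun e he => (hmemV _).2 (hlink e ((hmemE e).1 he)).left_mem
    have hh : ∀ e ∈ E, h e ∈ V := fun e he => (hmemV _).2 (hlink e ((hmemE e).1 he)).right_mem
    obtain ⟨T, hT, hdisj⟩ := exists_disjoint_arborescences hzV _ ht hh hcut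
    have hdeg : ∀ v, endCount E t {v} + endCount E h {v} = G.degree v := by
      intro v
      rw [← degree_restrict_eq hlink hEG.subset, hEG, restrict_self]
    have hdeg' : ∀ v, endCount E a {v} + endCount E b {v} = G.degree v := by
      intro v
      rw [← degree_restrict_eq hab hEG.subset, hEG, restrict_self]
    simp only [hdeg'] at hlow hhz
    obtain ⟨F, hFE, hTF, hTF', hFf, hFl, hFu, hFz⟩ := exists_parity_subset hzV hw hwz ht hh
      (fun i => (hT i).1) (fun i => (hT i).2) hdisj (fun v _ => hdeg v) hlow hhz hf hr1 hr2 hrf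
    have hdegZ : ∀ v, (endCount E t {v} + endCount E h {v} : ℤ) = G.degree v := by
      exact_mod_cast hdeg
    refine ⟨G.restrict F, isBoundedTreeFactor_restrict hVG hEG hlink hzV hFE
      (fun i => (hT (Fin.castAdd (m₀ + 1) i)).2) (fun i j hij => hdisj _ _ (by simpa using hij))
      hTF (fun j => (hT (Fin.natAdd m j.castSucc)).2)
      (fun i j hij => hdisj _ _ (by simpa using hij)) (fun j => (hT _).1) hTF' hFf
      (fun v hv => ?_) (fun v hv => ?_), ?_⟩
    · rw [hdegZ]
      exact hFl v hv
    · rw [hdegZ]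
      exact hFu v hv
    · rw [degree_restrict_eq hlink (by rw [← hEG]; exact_mod_cast hFE)]
      exact_mod_cast hFz
  · push Not at hone
    -- With a single vertex all edges are loops and the empty arborescence spans; any `r / 2` loops
    -- give degree `r`, which is even because `f z = 0`.
    have hloop : ∀ F ⊆ E, ∀ p : β → α, (∀ e ∈ E, p e ∈ V) → endCount F p {z} = F.card := by
      intro F hF p hp
      unfold endCount
      rw [Finset.filter_true_of_mem]
      exact fun e he => by simpa using hone _ (hp e (hF he))
    have hdeg : G.degree z = E.card + E.card := by
      have h := degree_restrict_eq hab hEG.subset z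
      rw [hloop E subset_rfl a ha, hloop E subset_rfl b hb, hEG, restrict_self] at h
      exact h
    have hVz : V = {z} := Finset.eq_singleton_iff_unique_mem.2 ⟨hzV, hone⟩
    obtain ⟨hr0, hrd⟩ := hrd (by rw [← hVG, hVz, Finset.coe_singleton])
    rw [hVz, Finset.sum_singleton] at hf
    obtain ⟨s, hs⟩ := (even_iff_intCast_eq_zero r).2 (hrf.trans hf)
    lift s to ℕ using by omega
    obtain ⟨F, hFE, hFs⟩ := Finset.exists_subset_card_eq (show s ≤ E.card by omega)
    have hnil : IsArborescence V (∅ : Finset β) a b z :=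
      ⟨⟨0, by simp⟩, by simp, by simp, fun v hv => by simp [endCount, hone v hv]⟩
    have hFr : (endCount F a {z} + endCount F b {z} : ℤ) = r := by
      rw [hloop F hFE a ha, hloop F hFE b hb, hFs, hs]
    have hdegZ : (endCount E a {z} + endCount E b {z} : ℤ) = G.degree z := by
      rw [hloop E subset_rfl a ha, hloop E subset_rfl b hb, hdeg]
      push_cast
      rfl
    refine ⟨G.restrict F, isBoundedTreeFactor_restrict hVG hEG hab hzV hFE
      (T := fun _ => ∅) (fun _ => hnil) (by simp) (by simp) (T' := fun _ => ∅) (fun _ => hnil)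
      (by simp) (by simp) (by simp) (fun v hv => ?_) (fun v hv => ?_) (fun v hv => ?_), ?_⟩
    · rw [hone v hv, hFr, hrf]
    · rw [hone v hv, hFr, hdegZ]
      exact hr1
    · rw [hone v hv, hFr, hdegZ]
      exact hr2
    · rw [degree_restrict_eq hab (by rw [← hEG]; exact_mod_cast hFE)]
      exact_mod_cast hFr

end Graph

theorem mainTheorem7 {α β : Type*} (G : Graph α β) (hV : V(G).Finite) (hE : E(G).Finite)
    (m m₀ : ℕ) (f : α → ZMod 2) (hf : ∑ v ∈ hV.toFinset, f v = 0)
    (hG : G.EdgeConnected (2 * m + 2 * m₀ + 2)) :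
    (∃ H : Graph α β, G.IsBoundedTreeFactor H f m m₀) ∧
    ∀ z ∈ V(G), ∀ t : ℤ,
      ⌊(G.degree z : ℚ) / 2⌋ - 1 - (m₀ : ℤ) ≤ t → t ≤ ⌈(G.degree z : ℚ) / 2⌉ + 1 + (m : ℤ) →
      0 ≤ t → t ≤ (G.degree z : ℤ) → (t : ZMod 2) = f z →
      ∃ H : Graph α β, G.IsBoundedTreeFactor H f m m₀ ∧ (H.degree z : ℤ) = t := by
  refine ⟨?_, fun z hz r hr1 hr2 hr0 hrd hrf => ?_⟩
  · obtain ⟨z, hz⟩ : V(G).Nonempty := by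
      simpa using (hG ∅ (Set.empty_subset _) (by simp)).1
    obtain ⟨x, hx, hxf⟩ := Arcs.exists_int_add_eq (((G.degree z : ℤ) / 2 : ℤ) : ZMod 2) (f z)
    have hrd : V(G) = {z} → 0 ≤ (G.degree z : ℤ) / 2 + x ∧
        (G.degree z : ℤ) / 2 + x ≤ G.degree z := by
      intro hVz
      refine ⟨by omega, ?_⟩
      -- Rounding up for parity could exceed the degree only if the degree is 0; on a single vertex
      -- `f z = 0` then excludes `x = 1`.
      by_cases hd : G.degree z = 0
      · have hfz : f z = 0 := by
          have : hV.toFinset = {z} := by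
            ext v
            simp [hVz]
          rwa [this, Finset.sum_singleton] at hf
        rcases hx with rfl | rfl
        · omega
        · simp [hd, hfz] at hxf
      · omega
    obtain ⟨H, hH, -⟩ := Graph.exists_isBoundedTreeFactor_degree_eq hV hE hf hG hz
      (r := (G.degree z : ℤ) / 2 + x) (by omega) (by omega) hrd (by rw [← hxf, Int.cast_add])
    exact ⟨H, hH⟩
  · rw [Graph.floor_natCast_div_two] at hr1
    rw [Graph.ceil_natCast_div_two] at hr2
    exact Graph.exists_isBoundedTreeFactor_degree_eq hV hE hf hG hz hr1 hr2
      (fun _ => ⟨hr0, hrd⟩) hrf
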